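/- \textbf{Conventions.} $\mathscr P(\mathbf R^n)$ is the set of positive measurable functions $\omega$ on $\mathbf R^n$ for which there are $C,N$ with $\omega(x+y)\le C\omega(x)(1+|y|)^N$ for all $x,y$. A weight $v\in\mathscr P(\mathbf R^n)$ is \emph{submultiplicative} if it is even and $v(x+y)\le Cv(x)v(y)$ for some constant $C$. A Banach space $\mathscr B$ of complex-valued measurable functions on $\mathbf R^n$ (modulo equality a.e.) is a \emph{translation invariant BF-space} (with respect to a submultiplicative $v\in\mathscr P(\mathbf R^n)$) if there is a constant $C$ such that: (1) $\mathscr S(\mathbf R^n)\subseteq\mathscr B\subseteq\mathscr S'(\mathbf R^n)$ with continuous embeddings; (2) if $F\in\mathscr B$ and $x\in\mathbf R^n$, then $F(\cdot-x)\in\mathscr B$ and $\|F(\cdot-x)\|_{\mathscr B}\le Cv(x)\|F\|_{\mathscr B}$; (3) if $G\in\mathscr B$, $F$ is measurable and $|F|\le|G|$ a.e., then $F\in\mathscr B$ and $\|F\|_{\mathscr B}\le C\|G\|_{\mathscr B}$. We put $\|F\|_{\mathscr B}=\infty$ if $F\notin\mathscr B$. Let $\mathscr B$ be a translation invariant BF-space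 on $\mathbf R^{2d}=\mathbf R^d\times\mathbf R^d$. Fix $\varphi_0\in\mathscr S(\mathbf R^d)\setminus 0$, and let the \emph{projection space} $\mathscr B_0$ consist of all $g$ on $\mathbf R^d$ such that $\varphi_0\otimes g\in\mathscr B$, with norm $\|g\|_{\mathscr B_0}=\|\varphi_0\otimes g\|_{\mathscr B}$. Let $\omega\in\mathscr P(\mathbf R^{2d})$, fix a point $x\in\mathbf R^d$ and a window $\phi\in\mathscr S(\mathbf R^d)\setminus 0$. For $u\in\mathscr E'(\mathbf R^d)$ put $$\widehat u(\xi)=(2\pi)^{-d/2}\langle u,e^{-i\langle\cdot,\xi\rangle}\rangle,\qquad V_\phi u(y,\xi)=(2\pi)^{-d/2}\langle u,\overline{\phi(\cdot-y)}\,e^{-i\langle\cdot,\xi\rangle}\rangle,$$ and, for an open cone $\Gamma\subseteq\mathbf R^d\setminus 0$ with characteristic function $\chi_\Gamma$, $$|u|_{\mathscr F\mathscr B_0(\omega),\Gamma}=\|\widehat u\,\omega(x,\cdot)\,\chi_\Gamma\|_{\mathscr B_0},\qquad |u|_{M(\omega,\mathscr B),\Gamma}=\|V_\phi u\cdot\omega\cdot(1\otimes\chi_\Gamma)\|_{\mathscr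 B}.$$ For $\mathcal B=\mathscr F\mathscr B_0(\omega)$ or $\mathcal B=M(\omega,\mathscr B)$ let $\Sigma_{\mathcal B}(u)$ be the set of $\xi\in\mathbf R^d\setminus 0$ such that $|u|_{\mathcal B,\Gamma}=\infty$ for every open cone $\Gamma\subseteq\mathbf R^d\setminus0$ containing $\xi$. For $X\subseteq\mathbf R^d$ open and $f\in\mathscr D'(X)$, the wave-front set $\operatorname{WF}_{\mathcal B}(f)$ is the set of $(x_0,\xi_0)\in X\times(\mathbf R^d\setminus 0)$ such that $\xi_0\in\Sigma_{\mathcal B}(\chi f)$ for every $\chi\in C_0^\infty(X)$ with $\chi(x_0)\ne0$. \textbf{Theorem.} Let $\mathscr B$ be a translation invariant BF-space on $\mathbf R^{2d}$, $\mathscr B_0$ its projection space on $\mathbf R^d$, $\omega\in\mathscr P(\mathbf R^{2d})$, $X\subseteq\mathbf R^d$ open, and $f\in\mathscr D'(X)$. Then, for every choice of $\varphi_0\in\mathscr S(\mathbf R^d)\setminus0$, of the point $x\in\mathbf R^d$ and of the window $\phi\in\mathscr S(\mathbf R^d)\setminus0$ in these definitions, $$\operatorname{WF}_{\mathscr F\mathscr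 B_0(\omega)}(f)=\operatorname{WF}_{M(\omega,\mathscr B)}(f).$$ -/

import Mathlib

open MeasureTheory Filter Topology Set TopologicalSpace
open scoped ENNReal SchwartzMap Distributions ComplexConjugate

noncomputable section

namespace WFModulation

/-! ### Weights -/

/-- The class `𝒫(V)` of polynomially moderate weights: positive measurable functions with
`ω (x + y) ≤ C ω(x) (1 + |y|)^N`. Such functions are automatically locally bounded. -/
structure IsModerateWeight {V : Type*} [NormedAddCommGroup V] [MeasurableSpace V]
    (ω : V → ℝ) : Prop where
  measurable : Measurable ω
  pos : ∀ x, 0 < ω x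
  moderate : ∃ (C : ℝ) (N : ℕ), ∀ x y, ω (x + y) ≤ C * ω x * (1 + ‖y‖) ^ N

/-- Submultiplicative weights in `𝒫(V)`; submultiplicative weights are assumed to be even. -/
structure IsSubmultiplicativeWeight {V : Type*} [NormedAddCommGroup V] [MeasurableSpace V]
    (v : V → ℝ) : Prop extends IsModerateWeight v where
  even : ∀ x, v (-x) = v x
  submul : ∃ C : ℝ, ∀ x y, v (x + y) ≤ C * v x * v y

/-! ### Translation invariant BF-spaces -/

section BF

variable {V : Type*} [NormedAddCommGroup V] [NormedSpace ℝ V] [MeasureSpace V]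
variable {𝓑 : Type*} [NormedAddCommGroup 𝓑] [NormedSpace ℂ 𝓑]

/-- A Banach space `𝓑` of complex-valued measurable functions on `V` (modulo equality almost
everywhere), realised as such by the injective linear map `ι`, is a translation invariant BF-space
with respect to the weight `v`. -/
structure IsTranslationInvariantBFSpace (ι : 𝓑 →ₗ[ℂ] (V →ₘ[volume] ℂ)) (v : V → ℝ) : Prop where
  complete : CompleteSpace 𝓑
  injective : Function.Injective ι
  weight : IsSubmultiplicativeWeight v
  /-- `𝓢 ⊆ 𝓑` with continuous embedding. -/
  schwartz_embedding : ∃ j : 𝓢(V, ℂ) →L[ℂ] 𝓑, ∀ ψ : 𝓢(V, ℂ), ι (j ψ) =ᵐ[volume] ψ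
  /-- `𝓑 ⊆ 𝓢'` with continuous embedding. -/
  tempered_embedding : ∃ T : 𝓑 →L[ℂ] 𝓢'(V, ℂ), ∀ (b : 𝓑) (ψ : 𝓢(V, ℂ)),
    Integrable (fun y ↦ ι b y * ψ y) ∧ T b ψ = ∫ y, ι b y * ψ y
  /-- If `F ∈ 𝓑`, then `F(· - x) ∈ 𝓑` and `‖F(· - x)‖ ≤ C v(x) ‖F‖`. -/
  translation : ∃ C : ℝ, ∀ (b : 𝓑) (x : V), ∃ b' : 𝓑,
    ι b' =ᵐ[volume] (fun y ↦ ι b (y - x)) ∧ ‖b'‖ ≤ C * v x * ‖b‖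
  /-- If `G ∈ 𝓑` and `|F| ≤ |G|` almost everywhere, then `F ∈ 𝓑` and `‖F‖ ≤ C ‖G‖`. -/
  solid : ∃ C : ℝ, ∀ (F : V →ₘ[volume] ℂ) (b : 𝓑), (∀ᵐ y, ‖F y‖ ≤ ‖ι b y‖) →
    ∃ a : 𝓑, ι a = F ∧ ‖a‖ ≤ C * ‖b‖

/-- The norm of a function `F` in `𝓑`, with the value `∞` if `F` does not belong to `𝓑`. -/
def bfNorm (ι : 𝓑 →ₗ[ℂ] (V →ₘ[volume] ℂ)) (F : V → ℂ) : ℝ≥0∞ :=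
  ⨅ (b : 𝓑) (_ : ι b =ᵐ[volume] F), ‖b‖ₑ

end BF

/-! ### Euclidean space, compactly supported distributions and their transforms -/

/-- `ℝ^d` with its Euclidean structure. -/
abbrev Rd (d : ℕ) : Type := EuclideanSpace ℝ (Fin d)

section Euclidean

variable {d : ℕ}

/-- The projection space `𝓑₀` of a space `𝓑` of functions on `ℝ^d × ℝ^d`, determined by
`g ∈ 𝓑₀` if and only if `φ ⊗ g ∈ 𝓑`, presented through its norm `‖g‖_{𝓑₀} = ‖φ ⊗ g‖_𝓑` with
the value `∞` if `g ∉ 𝓑₀`. -/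
def projNorm {𝓑 : Type*} [NormedAddCommGroup 𝓑] [NormedSpace ℂ 𝓑]
    (ι : 𝓑 →ₗ[ℂ] (Rd d × Rd d →ₘ[volume] ℂ)) (φ : 𝓢(Rd d, ℂ)) (g : Rd d → ℂ) : ℝ≥0∞ :=
  bfNorm ι (fun p ↦ φ p.1 * g p.2)

/-- The test function `χ g`, for a test function `χ` and a smooth function `g`. -/
def mulSmooth {X : Opens (Rd d)} (χ : 𝓓(X, ℂ)) (g : Rd d → ℂ) (hg : ContDiff ℝ (⊤ : ℕ∞) g) :
    𝓓(X, ℂ) where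
  toFun y := χ y * g y
  contDiff' := χ.contDiff.mul hg
  hasCompactSupport' := χ.hasCompactSupport.mul_right
  tsupport_subset' := (tsupport_mul_subset_left).trans χ.tsupport_subset

/-- The value of a distribution on a complex-valued test function. -/
def pairing {X : Opens (Rd d)} (f : 𝓓'(X, ℂ)) (ψ : 𝓓(X, ℂ)) : ℂ :=
  f (TestFunction.postcompCLM Complex.reCLM ψ) +
    Complex.I * f (TestFunction.postcompCLM Complex.imCLM ψ)

/-- The compactly supported distribution `χ f ∈ ℰ'(ℝ^d)`, acting on smooth functions by
`⟨χ f, g⟩ = ⟨f, χ g⟩`. -/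
def cutoff {X : Opens (Rd d)} (f : 𝓓'(X, ℂ)) (χ : 𝓓(X, ℂ)) (g : Rd d → ℂ)
    (hg : ContDiff ℝ (⊤ : ℕ∞) g) : ℂ :=
  pairing f (mulSmooth χ g hg)

/-- The function `y ↦ exp (-i ⟨y, ξ⟩)`. -/
def character (ξ : Rd d) (y : Rd d) : ℂ :=
  Complex.exp (-Complex.I * ((inner ℝ y ξ : ℝ) : ℂ))

theorem contDiff_character (ξ : Rd d) : ContDiff ℝ (⊤ : ℕ∞) (character ξ) := by
  unfold character
  exact (contDiff_const.mul (Complex.ofRealCLM.contDiff.comp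
    (contDiff_id.inner ℝ contDiff_const))).cexp

theorem contDiff_window (ϕ : 𝓢(Rd d, ℂ)) (x ξ : Rd d) :
    ContDiff ℝ (⊤ : ℕ∞) (fun y : Rd d ↦ conj (ϕ (y - x)) * character ξ y) :=
  (Complex.conjCLE.contDiff.comp
    (ϕ.smooth'.comp (contDiff_id.sub contDiff_const))).mul (contDiff_character ξ)

/-- The Fourier transform of `χ f ∈ ℰ'(ℝ^d)`, a smooth function:
`ξ ↦ (2π)^{-d/2} ⟨χ f, exp(-i ⟨·, ξ⟩)⟩`. -/
def fourier {X : Opens (Rd d)} (f : 𝓓'(X, ℂ)) (χ : 𝓓(X, ℂ)) (ξ : Rd d) : ℂ :=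
  (((2 * Real.pi) ^ (-(d : ℝ) / 2) : ℝ) : ℂ) *
    cutoff f χ (character ξ) (contDiff_character ξ)

/-- The short-time Fourier transform of `χ f ∈ ℰ'(ℝ^d)` with window `ϕ`:
`(x, ξ) ↦ (2π)^{-d/2} ⟨χ f, conj (ϕ(· - x)) exp(-i ⟨·, ξ⟩)⟩`. -/
def stft {X : Opens (Rd d)} (ϕ : 𝓢(Rd d, ℂ)) (f : 𝓓'(X, ℂ)) (χ : 𝓓(X, ℂ))
    (p : Rd d × Rd d) : ℂ :=
  (((2 * Real.pi) ^ (-(d : ℝ) / 2) : ℝ) : ℂ) *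
    cutoff f χ (fun y ↦ conj (ϕ (y - p.1)) * character p.2 y) (contDiff_window ϕ p.1 p.2)

/-! ### Wave-front sets -/

/-- Open cones in `ℝ^d ∖ 0`. -/
structure IsOpenCone (Γ : Set (Rd d)) : Prop where
  isOpen : IsOpen Γ
  zero_notMem : (0 : Rd d) ∉ Γ
  smul_mem : ∀ t : ℝ, 0 < t → ∀ ξ ∈ Γ, t • ξ ∈ Γ

/-- The set `Θ` of regular directions of a fixed compactly supported distribution, given the
values `S Γ` of its semi-norms over the open cones `Γ`. -/
def regularDirections (S : Set (Rd d) → ℝ≥0∞) : Set (Rd d) :=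
  {ξ | ξ ≠ 0 ∧ ∃ Γ, IsOpenCone Γ ∧ ξ ∈ Γ ∧ S Γ < ∞}

/-- The complement `Σ` of `Θ` in `ℝ^d ∖ 0`. -/
def singularDirections (S : Set (Rd d) → ℝ≥0∞) : Set (Rd d) :=
  {ξ | ξ ≠ 0} \ regularDirections S

/-- The wave-front set in `X × (ℝ^d ∖ 0)` of a distribution `f` on `X`, given the semi-norms
`S χ Γ` of its localizations `χ f` over the open cones `Γ`. -/
def waveFrontSet (X : Opens (Rd d)) (S : 𝓓(X, ℂ) → Set (Rd d) → ℝ≥0∞) :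
    Set (Rd d × Rd d) :=
  {p | p.1 ∈ X ∧ p.2 ≠ 0 ∧ ∀ χ : 𝓓(X, ℂ), χ p.1 ≠ 0 → p.2 ∈ singularDirections (S χ)}

/-- The semi-norm `‖(χ f)^ ω(x, ·) 1_Γ‖` of `χ f` with respect to the Fourier BF-space of weight
`ω`, for the function space on `ℝ^d` with (possibly infinite) norm `N`. -/
def fourierSeminorm (N : (Rd d → ℂ) → ℝ≥0∞) (ω : Rd d × Rd d → ℝ) (x : Rd d)
    {X : Opens (Rd d)} (f : 𝓓'(X, ℂ)) (χ : 𝓓(X, ℂ)) (Γ : Set (Rd d)) : ℝ≥0∞ :=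
  N (Γ.indicator fun ξ ↦ fourier f χ ξ * (ω (x, ξ) : ℂ))

/-- The wave-front set with respect to the Fourier BF-space of weight `ω`, with reference
point `x`, for the function space on `ℝ^d` with norm `N`. -/
def waveFrontSetFourier (N : (Rd d → ℂ) → ℝ≥0∞) (ω : Rd d × Rd d → ℝ) (x : Rd d)
    {X : Opens (Rd d)} (f : 𝓓'(X, ℂ)) : Set (Rd d × Rd d) :=
  waveFrontSet X (fourierSeminorm N ω x f)

/-- The semi-norm `‖V_ϕ(χ f) ω 1_{ℝ^d × Γ}‖_𝓑` of `χ f` with respect to the modulation space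
`M(ω, 𝓑)`, computed with the window `ϕ`. -/
def modulationSeminorm {𝓑 : Type*} [NormedAddCommGroup 𝓑] [NormedSpace ℂ 𝓑]
    (ι : 𝓑 →ₗ[ℂ] (Rd d × Rd d →ₘ[volume] ℂ)) (ω : Rd d × Rd d → ℝ) (ϕ : 𝓢(Rd d, ℂ))
    {X : Opens (Rd d)} (f : 𝓓'(X, ℂ)) (χ : 𝓓(X, ℂ)) (Γ : Set (Rd d)) : ℝ≥0∞ :=
  bfNorm ι ((univ ×ˢ Γ).indicator fun p ↦ stft ϕ f χ p * (ω p : ℂ))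

/-- The wave-front set with respect to the modulation space `M(ω, 𝓑)`, computed with the
window `ϕ`. -/
def waveFrontSetModulation {𝓑 : Type*} [NormedAddCommGroup 𝓑] [NormedSpace ℂ 𝓑]
    (ι : 𝓑 →ₗ[ℂ] (Rd d × Rd d →ₘ[volume] ℂ)) (ω : Rd d × Rd d → ℝ) (ϕ : 𝓢(Rd d, ℂ))
    {X : Opens (Rd d)} (f : 𝓓'(X, ℂ)) : Set (Rd d × Rd d) :=
  waveFrontSet X (modulationSeminorm ι ω ϕ f)

end Euclidean

end WFModulation

end

/-! Write `u = χ f`. Both inclusions rest on the same device: on the support of `χ` a smooth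
function `g` is a Fourier series `∑ c_k exp(-i⟨z, εk⟩)` with rapidly decreasing coefficients, and
the finite order of `f` allows the series to be taken out of the pairing (`exists_expansion`).

Applied to `g = conj ϕ(· - y)`, this gives `V_ϕ u(y, ξ) = ∑ c_k(y) û(ξ + εk)`, where `c_k(y)` decays
rapidly in `k` and, since `z` stays in a compact set, also in `y`. Conversely, let `ϕ(w₀) ≠ 0`, let
`κ` invert `conj ϕ` near `w₀`, and let `ρ` be a bump at `x₀`. For `y` near `x₀ - w₀` the identity
`ρ(z) κ(z - y) conj ϕ(z - y) = ρ(z)` recovers the transform of `χρf` at `ξ` as `∑ c_k(y) V_ϕ u(y, ξ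
+ εk)`, with bounds uniform in such `y`. This shrinks the cutoff, which the definition of the
wave-front set tolerates.

Each transform is thus dominated by a series of frequency translates of the other. Such series stay
in `𝓑`, by completeness, solidity and the polynomial growth of `v`
(`exists_memBF_of_le_translates`). Cones are handled by `memBF_of_le_cone`: if `ξ ∈ Γ'` and `ξ + εk
∉ Γ`, then `|ξ + εk|` is controlled by `|εk|`, so the decay of `c_k` beats the polynomial growth of
the transform there.

In the variable `y`, a factor `φ₀(y)`, the indicator of a ball and a power `(1 + |y|)^{-N}` are
exchanged by covering `ℝ^d` with lattice translates of a ball (`exists_memBF_of_covering`). This is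
why neither `φ₀` nor the reference point `x` matters. -/

noncomputable section

namespace WFModulation

/-! ### Fourier series of functions supported in a cube -/

section FourierSeries

open scoped FourierTransform

variable {d : ℕ}

/-- The points of the lattice `ε ℤ^d`. -/
def lat (ε : ℝ) (k : Fin d → ℤ) : Rd d := WithLp.toLp 2 fun i ↦ ε * k i

theorem lat_apply (ε : ℝ) (k : Fin d → ℤ) (i : Fin d) : lat ε k i = ε * k i := rfl

theorem lat_eq_smul (ε : ℝ) (k : Fin d → ℤ) : lat ε k = ε • lat 1 k := by
  ext i; simp [lat_apply]

theorem inner_eq_sum (x y : Rd d) : inner ℝ x y = ∑ i, x i * y i := by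
  simp [PiLp.inner_apply, mul_comm]

theorem character_add (ξ η y : Rd d) : character (ξ + η) y = character ξ y * character η y := by
  simp [character, inner_add_right, ← Complex.exp_add, mul_add]

theorem fourier_eq_character (ψ : Rd d → ℂ) (w : Rd d) :
    𝓕 ψ w = ∫ z, character ((2 * Real.pi) • w) z * ψ z := by
  rw [Real.fourier_eq']
  refine integral_congr_ae (.of_forall fun z ↦ ?_)
  simp only [character, smul_eq_mul, inner_smul_right]
  congr 2
  push_cast
  ring

/-- The function on the torus obtained by rescaling a function supported in a cube of
side `L`. -/
def torusLift (L : ℝ) (ψ : Rd d → ℂ) (t : UnitAddTorus (Fin d)) : ℂ :=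
  ψ (WithLp.toLp 2 fun i ↦ L * (AddCircle.equivIoc (1 : ℝ) (-1 / 2) (t i)).1)

theorem norm_eq_abs_equivIoc (t : UnitAddCircle) :
    ‖t‖ = |(AddCircle.equivIoc (1 : ℝ) (-1 / 2) t).1| := by
  set s := AddCircle.equivIoc (1 : ℝ) (-1 / 2) t with hs
  have h1 : ((s : ℝ) : UnitAddCircle) = t := by
    exact (AddCircle.equivIoc (1 : ℝ) (-1 / 2)).symm_apply_apply t
  rw [← h1, (AddCircle.norm_coe_eq_abs_iff (1 : ℝ) one_ne_zero).2]
  have := s.2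
  rw [abs_le, abs_one]
  constructor <;> linarith [this.1, this.2]

theorem torusLift_eq_zero {L R : ℝ} (hR : 0 ≤ R) (hRL : 2 * R < L) {ψ : Rd d → ℂ}
    (hs : ∀ z, R < ‖z‖ → ψ z = 0) (t : UnitAddTorus (Fin d)) (i : Fin d) (ht : R / L < ‖t i‖) :
    torusLift L ψ t = 0 := by
  have hL : 0 < L := by linarith
  refine hs _ (lt_of_lt_of_le ?_ (PiLp.norm_apply_le _ i))
  rw [norm_eq_abs_equivIoc, div_lt_iff₀ hL] at ht
  simpa [abs_mul, abs_of_pos hL, mul_comm] using ht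

/-- The chosen representative in `(-1/2, 1/2]` jumps only at the half-integer class. There the
coordinate has norm `1/2 > R / L`, and the lift vanishes in a neighbourhood. -/
theorem continuous_torusLift {L R : ℝ} (hR : 0 ≤ R) (hRL : 2 * R < L) {ψ : Rd d → ℂ}
    (hψ : Continuous ψ) (hs : ∀ z, R < ‖z‖ → ψ z = 0) : Continuous (torusLift L ψ) := by
  have hL : 0 < L := by linarith
  rw [continuous_iff_continuousAt]
  intro t
  by_cases h : ∃ i, R / L < ‖t i‖
  · obtain ⟨i, hi⟩ := h
    have : ∀ᶠ t' : UnitAddTorus (Fin d) in 𝓝 t, torusLift L ψ t' = 0 := by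
      have ho : IsOpen {t' : UnitAddTorus (Fin d) | R / L < ‖t' i‖} :=
        isOpen_lt continuous_const (continuous_apply i).norm
      filter_upwards [ho.mem_nhds hi] with t' ht'
      exact torusLift_eq_zero hR hRL hs t' i ht'
    exact (continuousAt_congr this).2 continuousAt_const
  · push Not at h
    refine hψ.continuousAt.comp (f := fun t : UnitAddTorus (Fin d) ↦ (WithLp.toLp 2 fun i ↦
      L * (AddCircle.equivIoc (1 : ℝ) (-1 / 2) (t i)).1 : Rd d)) ?_
    refine (PiLp.continuous_toLp 2 _).continuousAt.comp ?_
    refine continuousAt_pi.2 fun i ↦ continuousAt_const.mul ?_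
    refine continuous_subtype_val.continuousAt.comp ?_
    refine ContinuousAt.comp (f := fun t : UnitAddTorus (Fin d) ↦ t i) ?_
      (continuous_apply i).continuousAt
    refine AddCircle.continuousAt_equivIoc 1 (-1 / 2) fun hi ↦ ?_
    have h1 := h i
    rw [hi, (AddCircle.norm_coe_eq_abs_iff (1 : ℝ) one_ne_zero).2 (by norm_num [abs_le]),
      le_div_iff₀ hL] at h1
    norm_num at h1
    have : |(-1 / 2 : ℝ)| = 1 / 2 := by norm_num [abs_div]
    linarith

theorem mFourier_coe (k : Fin d → ℤ) (x : Fin d → ℝ) :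
    UnitAddTorus.mFourier k (fun i ↦ (x i : UnitAddCircle)) =
      character (lat (-2 * Real.pi) k) (WithLp.toLp 2 x) := by
  simp only [UnitAddTorus.mFourier, ContinuousMap.coe_mk, fourier_coe_apply, ← Complex.exp_sum,
    character, inner_eq_sum, lat_apply]
  congr 1
  push_cast
  rw [Finset.mul_sum]
  refine Finset.sum_congr rfl fun i _ ↦ ?_
  simp
  ring

theorem equivIoc_coe_of_mem {x : ℝ} (hx : x ∈ Ioc (-1 / 2 : ℝ) (-1 / 2 + 1)) :
    (AddCircle.equivIoc (1 : ℝ) (-1 / 2) (x : UnitAddCircle)).1 = x := by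
  have := AddCircle.equivIoc_coe_of_mem (p := (1 : ℝ)) (a := -1 / 2) hx
  simpa using this

/-- Substitute `z = L x` in the integral over the unit cube. Outside that cube `|L x_i| ≥ L / 2 > R`
for some `i`, so the integral extends to the whole space and becomes a Fourier transform. -/
theorem mFourierCoeff_torusLift {L R : ℝ} (hR : 0 ≤ R) (hRL : 2 * R < L) {ψ : Rd d → ℂ}
    (hs : ∀ z, R < ‖z‖ → ψ z = 0) (k : Fin d → ℤ) :
    UnitAddTorus.mFourierCoeff (torusLift L ψ) k = ((L : ℂ) ^ d)⁻¹ * 𝓕 ψ (lat L⁻¹ k) := by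
  have hL : 0 < L := by linarith
  have hbox : MeasurableSet {x : Fin d → ℝ | ∀ i, x i ∈ Ioc (-1 / 2 : ℝ) (-1 / 2 + 1)} :=
    MeasurableSet.univ_pi' fun i ↦ measurableSet_Ioc
  let g : Rd d → ℂ := fun z ↦ character (lat (2 * Real.pi * L⁻¹) k) z * ψ z
  rw [UnitAddTorus.mFourierCoeff_eq_integral _ _ (fun _ ↦ -1 / 2),
    setIntegral_congr_fun (g := fun x ↦ g (L • (WithLp.toLp 2 x : Rd d))) hbox,
    setIntegral_eq_integral_of_forall_compl_eq_zero]
  · have h1 := (EuclideanSpace.volume_preserving_symm_measurableEquiv_toLp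
      (Fin d)).symm.integral_comp' (fun z : Rd d ↦ g (L • z))
    refine h1.trans ?_
    rw [Measure.integral_comp_smul, fourier_eq_character]
    simp only [finrank_euclideanSpace, Fintype.card_fin, g]
    rw [abs_of_pos (by positivity), Complex.real_smul]
    push_cast
    congr 2
    ext z
    congr 2
    ext i
    simp [lat_apply, mul_assoc]
  · intro x hx
    simp only [mem_ofPred_eq, not_forall] at hx
    obtain ⟨i, hi⟩ := hx
    have : ψ (L • (WithLp.toLp 2 x : Rd d)) = 0 := by
      refine hs _ (lt_of_lt_of_le ?_ (PiLp.norm_apply_le _ i))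
      have h1 : (1 : ℝ) / 2 ≤ |x i| := by
        by_contra! hlt
        rw [abs_lt] at hlt
        exact hi ⟨by linarith [hlt.1], by linarith [hlt.2]⟩
      simp [abs_of_pos hL]
      nlinarith
    simp [g, this]
  · intro x hx
    simp only [smul_eq_mul, torusLift, g]
    rw [mFourier_coe]
    congr 1
    · simp only [character]
      congr 3
      simp only [inner_eq_sum, lat_apply]
      refine Finset.sum_congr rfl fun i _ ↦ ?_
      simp
      field_simp
    · congr 1
      ext i
      simp [equivIoc_coe_of_mem (hx i)]

/-- Fourier inversion for functions supported in a cube of side `L`, by means of Fourier series. -/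
theorem hasSum_fourier_series {L R : ℝ} (hR : 0 ≤ R) (hRL : 2 * R < L) {ψ : Rd d → ℂ}
    (hψ : Continuous ψ) (hs : ∀ z, R < ‖z‖ → ψ z = 0)
    (hsum : Summable fun k : Fin d → ℤ ↦ 𝓕 ψ (lat L⁻¹ k)) {z : Rd d} (hz : ‖z‖ ≤ R) :
    HasSum (fun k : Fin d → ℤ ↦ ((L : ℂ) ^ d)⁻¹ * 𝓕 ψ (lat L⁻¹ k) *
      character (lat (-2 * Real.pi / L) k) z) (ψ z) := by
  have hL : 0 < L := by linarith
  let F : C(UnitAddTorus (Fin d), ℂ) := ⟨torusLift L ψ, continuous_torusLift hR hRL hψ hs⟩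
  have hF : UnitAddTorus.mFourierCoeff F = fun k ↦ ((L : ℂ) ^ d)⁻¹ * 𝓕 ψ (lat L⁻¹ k) :=
    funext fun k ↦ mFourierCoeff_torusLift hR hRL hs k
  have h := UnitAddTorus.hasSum_mFourier_series_apply_of_summable (f := F)
    (by rw [hF]; exact hsum.mul_left _) (fun i ↦ ((z i / L : ℝ) : UnitAddCircle))
  have hz' : ∀ i, z i / L ∈ Ioc (-1 / 2 : ℝ) (-1 / 2 + 1) := fun i ↦ by
    have h1 : |z i| ≤ R := (PiLp.norm_apply_le z i).trans hz
    rw [abs_le] at h1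
    rw [mem_Ioc, lt_div_iff₀ hL, div_le_iff₀ hL]
    constructor <;> linarith [h1.1, h1.2]
  convert h using 1
  · funext k
    rw [hF, smul_eq_mul, mFourier_coe]
    congr 1
    simp only [character]
    congr 3
    simp only [inner_eq_sum, lat_apply]
    refine Finset.sum_congr rfl fun i _ ↦ ?_
    field_simp
  · change _ = torusLift L ψ _
    unfold torusLift
    congr 1
    ext i
    simp only [equivIoc_coe_of_mem (hz' i)]
    field_simp

end FourierSeries

/-! ### Finite order of distributions and termwise pairing with series -/

section Pairing

variable {d : ℕ} {X : Opens (Rd d)}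

@[simp]
theorem mulSmooth_apply (χ : 𝓓(X, ℂ)) (g : Rd d → ℂ) (hg : ContDiff ℝ (⊤ : ℕ∞) g) (y : Rd d) :
    mulSmooth χ g hg y = χ y * g y := rfl

theorem pairing_add (f : 𝓓'(X, ℂ)) (ψ₁ ψ₂ : 𝓓(X, ℂ)) :
    pairing f (ψ₁ + ψ₂) = pairing f ψ₁ + pairing f ψ₂ := by
  simp only [pairing, map_add]
  ring

/-- A distribution acts on real test functions; its extension through real and imaginary parts is
complex linear because `I² = -1`. -/
theorem pairing_smul (f : 𝓓'(X, ℂ)) (c : ℂ) (ψ : 𝓓(X, ℂ)) :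
    pairing f (c • ψ) = c * pairing f ψ := by
  have h1 : TestFunction.postcompCLM Complex.reCLM (c • ψ) =
      c.re • TestFunction.postcompCLM Complex.reCLM ψ -
        c.im • TestFunction.postcompCLM Complex.imCLM ψ := by
    ext y; simp
  have h2 : TestFunction.postcompCLM Complex.imCLM (c • ψ) =
      c.re • TestFunction.postcompCLM Complex.imCLM ψ +
        c.im • TestFunction.postcompCLM Complex.reCLM ψ := by
    ext y; simp
  simp only [pairing, h1, h2, map_add, map_sub, map_smul, Complex.real_smul]
  conv_rhs => rw [← Complex.re_add_im c]
  linear_combination (-(c.im : ℂ) * f (TestFunction.postcompCLM Complex.imCLM ψ)) * Complex.I_sq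

/-- The pairing with a distribution, as a linear form on complex-valued test functions. -/
def pairingLM (f : 𝓓'(X, ℂ)) : 𝓓(X, ℂ) →ₗ[ℂ] ℂ where
  toFun := pairing f
  map_add' := pairing_add f
  map_smul' := pairing_smul f

/-- A distribution has finite order on every compact set. -/
theorem exists_norm_pairing_le (f : 𝓓'(X, ℂ)) (K : Compacts (Rd d)) (hK : (K : Set (Rd d)) ⊆ X) :
    ∃ (C : ℝ) (m : ℕ), 0 ≤ C ∧ ∀ ψ : 𝓓(X, ℂ), tsupport ψ ⊆ K → ∀ M : ℝ, 0 ≤ M →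
      (∀ n ≤ m, ∀ z, ‖iteratedFDeriv ℝ n ψ z‖ ≤ M) → ‖pairing f ψ‖ ≤ C * M := by
  let T : 𝓓_{K}(Rd d, ℂ) →ₗ[ℝ] ℂ :=
    { toFun := fun ψ ↦ pairing f (TestFunction.ofSupportedIn hK ψ)
      map_add' := fun a b ↦ by
        have h : TestFunction.ofSupportedIn hK (a + b) =
            TestFunction.ofSupportedIn hK a + TestFunction.ofSupportedIn hK b := rfl
        rw [h, pairing_add]
      map_smul' := fun c a ↦ by
        have h : TestFunction.ofSupportedIn hK (c • a) =
            (c : ℂ) • TestFunction.ofSupportedIn hK a := by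
          ext y
          exact (Complex.real_smul (x := c) (z := a y))
        rw [RingHom.id_apply, Complex.real_smul, ← pairing_smul, h] }
  have hT : Continuous T := by
    change Continuous fun ψ : 𝓓_{K}(Rd d, ℂ) ↦
      f (TestFunction.postcompCLM Complex.reCLM (TestFunction.ofSupportedIn hK ψ)) +
      Complex.I * f (TestFunction.postcompCLM Complex.imCLM (TestFunction.ofSupportedIn hK ψ))
    have h1 : ∀ L : ℂ →L[ℝ] ℝ, Continuous fun ψ : 𝓓_{K}(Rd d, ℂ) ↦
        f (TestFunction.postcompCLM L (TestFunction.ofSupportedIn hK ψ)) := fun L ↦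
      (map_continuous f).comp ((TestFunction.postcompCLM L).continuous.comp
        (TestFunction.continuous_ofSupportedIn hK))
    exact (h1 _).add (continuous_const.mul (h1 _))
  obtain ⟨s, C, -, hC⟩ := Seminorm.bound_of_continuous
    (ContDiffMapSupportedIn.withSeminorms ℝ (Rd d) ℂ ⊤ K) ((normSeminorm ℝ ℂ).comp T)
    (by exact hT.norm)
  -- The order `m` is the largest derivative occurring in the finite set `s` of seminorms.
  refine ⟨C, s.sup id, C.2, fun ψ hψ M hM hb ↦ ?_⟩
  let ψ' : 𝓓_{K}(Rd d, ℂ) := .of_support_subset ψ.contDiff (subset_closure.trans hψ)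
  have h1 := hC ψ'
  have h2 : T ψ' = pairing f ψ := congrArg (pairing f) (by ext; rfl)
  simp only [Seminorm.comp_apply, coe_normSeminorm, h2, smul_apply] at h1
  refine h1.trans (mul_le_mul_of_nonneg_left ?_ C.2)
  refine Seminorm.finset_sup_apply_le hM fun i hi ↦ ?_
  exact (ContDiffMapSupportedIn.seminorm_top_le_iff ℝ hM i ψ').2 fun z _ ↦
    hb i (Finset.le_sup (f := id) hi) z

theorem iteratedDeriv_cexp_neg_I (n : ℕ) :
    (iteratedDeriv n fun t : ℝ ↦ Complex.exp (-Complex.I * t)) =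
      fun t : ℝ ↦ (-Complex.I) ^ n * Complex.exp (-Complex.I * t) := by
  induction n with
  | zero => simp
  | succ n ih =>
    rw [iteratedDeriv_succ, ih]
    funext t
    have : HasDerivAt (fun t : ℝ ↦ (-Complex.I) ^ n * Complex.exp (-Complex.I * t))
        ((-Complex.I) ^ n * (Complex.exp (-Complex.I * t) * (-Complex.I * 1))) t :=
      (((Complex.ofRealCLM.hasDerivAt (x := t)).const_mul (-Complex.I)).cexp).const_mul _
    rw [this.deriv]
    ring

theorem norm_iteratedFDeriv_character_le (ξ : Rd d) (n : ℕ) (z : Rd d) :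
    ‖iteratedFDeriv ℝ n (character ξ) z‖ ≤ ‖ξ‖ ^ n := by
  have h1 : character ξ = (fun t : ℝ ↦ Complex.exp (-Complex.I * t)) ∘ innerSL ℝ ξ := by
    funext y; simp [character, real_inner_comm]
  have h2 : ContDiff ℝ (⊤ : ℕ∞) fun t : ℝ ↦ Complex.exp (-Complex.I * t) :=
    (contDiff_const.mul Complex.ofRealCLM.contDiff).cexp
  rw [h1, ContinuousLinearMap.iteratedFDeriv_comp_right _ h2 _ (mod_cast le_top)]
  refine (ContinuousMultilinearMap.norm_compContinuousLinearMap_le _ _).trans ?_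
  rw [norm_iteratedFDeriv_eq_norm_iteratedDeriv, iteratedDeriv_cexp_neg_I]
  simp [Complex.norm_exp, innerSL_apply_norm]

theorem norm_iteratedFDeriv_mul_le_of_le {a b : Rd d → ℂ} (ha : ContDiff ℝ (⊤ : ℕ∞) a)
    (hb : ContDiff ℝ (⊤ : ℕ∞) b) {z : Rd d} {n : ℕ} {A B : ℝ} (hA0 : 0 ≤ A)
    (hA : ∀ i ≤ n, ‖iteratedFDeriv ℝ i a z‖ ≤ A) (hB : ∀ i ≤ n, ‖iteratedFDeriv ℝ i b z‖ ≤ B) :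
    ‖iteratedFDeriv ℝ n (fun y ↦ a y * b y) z‖ ≤ 2 ^ n * (A * B) := by
  refine (norm_iteratedFDeriv_mul_le ha hb z (mod_cast le_top)).trans ?_
  have : (2 : ℝ) ^ n = ∑ i ∈ Finset.range (n + 1), (n.choose i : ℝ) := by
    exact_mod_cast (Nat.sum_range_choose n).symm
  rw [this, Finset.sum_mul]
  refine Finset.sum_le_sum fun i hi ↦ ?_
  rw [mul_assoc]
  refine mul_le_mul_of_nonneg_left ?_ (by positivity)
  have hi' : i ≤ n := Nat.lt_succ_iff.1 (Finset.mem_range.1 hi)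
  exact mul_le_mul (hA i hi') (hB _ (Nat.sub_le _ _)) (norm_nonneg _) hA0

theorem exists_norm_iteratedFDeriv_le (ψ : 𝓓(X, ℂ)) (m : ℕ) :
    ∃ A : ℝ, 0 ≤ A ∧ ∀ n ≤ m, ∀ z, ‖iteratedFDeriv ℝ n ψ z‖ ≤ A := by
  have h : ∀ n, ∃ A : ℝ, ∀ z, ‖iteratedFDeriv ℝ n ψ z‖ ≤ A := fun n ↦
    Continuous.bounded_above_of_compact_support
      (ψ.contDiff.continuous_iteratedFDeriv (mod_cast le_top))
      (ψ.hasCompactSupport.iteratedFDeriv n)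
  choose A hA using h
  refine ⟨∑ n ∈ Finset.range (m + 1), A n,
    Finset.sum_nonneg fun n _ ↦ (norm_nonneg _).trans (hA n 0), fun n hn z ↦ (hA n z).trans ?_⟩
  exact Finset.single_le_sum (f := A) (fun n _ ↦ (norm_nonneg _).trans (hA n 0))
    (Finset.mem_range.2 (Nat.lt_succ_of_le hn))

theorem norm_iteratedFDeriv_mul_character_le {ψ : Rd d → ℂ} (hψ : ContDiff ℝ (⊤ : ℕ∞) ψ) {m : ℕ}
    {A : ℝ} (hA0 : 0 ≤ A) {z : Rd d} (hA : ∀ n ≤ m, ‖iteratedFDeriv ℝ n ψ z‖ ≤ A) (ξ : Rd d)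
    {n : ℕ} (hn : n ≤ m) :
    ‖iteratedFDeriv ℝ n (fun y ↦ ψ y * character ξ y) z‖ ≤ 2 ^ m * A * (1 + ‖ξ‖) ^ m := by
  have h1 := norm_iteratedFDeriv_mul_le_of_le (n := n) (B := (1 + ‖ξ‖) ^ m) hψ
    (contDiff_character ξ) hA0 (fun i hi ↦ hA i (hi.trans hn)) (fun i hi ↦ ?_)
  · refine h1.trans ?_
    rw [mul_assoc]
    gcongr
    norm_num
  · calc _ ≤ ‖ξ‖ ^ i := norm_iteratedFDeriv_character_le ξ i z
      _ ≤ (1 + ‖ξ‖) ^ i := by gcongr; linarith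
      _ ≤ (1 + ‖ξ‖) ^ m := pow_le_pow_right₀ (by linarith [norm_nonneg ξ]) (hi.trans hn)

/-- Expansions in characters with rapidly decreasing coefficients can be summed outside the pairing
with a distribution. -/
theorem hasSum_pairing_character {κ : Type*} (f : 𝓓'(X, ℂ)) (ψ : 𝓓(X, ℂ)) {g : Rd d → ℂ}
    (hg : ContDiff ℝ (⊤ : ℕ∞) g) (c : κ → ℂ) (ξ : κ → Rd d)
    (hc : ∀ n : ℕ, Summable fun k ↦ ‖c k‖ * (1 + ‖ξ k‖) ^ n)
    (hsum : ∀ z, ψ z ≠ 0 → HasSum (fun k ↦ c k * character (ξ k) z) (g z)) :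
    HasSum (fun k ↦ c k * pairing f (mulSmooth ψ (character (ξ k)) (contDiff_character _)))
      (pairing f (mulSmooth ψ g hg)) := by
  classical
  obtain ⟨C, m, hC0, hC⟩ := exists_norm_pairing_le f ⟨tsupport ψ, ψ.hasCompactSupport⟩
    ψ.tsupport_subset
  obtain ⟨A, hA0, hA⟩ := exists_norm_iteratedFDeriv_le ψ m
  let e : κ → 𝓓(X, ℂ) := fun k ↦ mulSmooth ψ (character (ξ k)) (contDiff_character _)
  let w : κ → ℝ := fun k ↦ 2 ^ m * A * (‖c k‖ * (1 + ‖ξ k‖) ^ m)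
  have hw : Summable w := (hc m).mul_left _
  have hcont : ∀ k, ContDiff ℝ (⊤ : ℕ∞) fun z ↦ c k * (ψ z * character (ξ k) z) := fun k ↦
    contDiff_const.mul (ψ.contDiff.mul (contDiff_character _))
  have hbd : ∀ k, ∀ n ≤ m, ∀ z, ‖iteratedFDeriv ℝ n (fun z ↦ c k * (ψ z * character (ξ k) z)) z‖
      ≤ w k := fun k n hn z ↦ by
    have h1 := iteratedFDeriv_const_smul_apply' (𝕜 := ℝ) (i := n) (a := c k) (x := z)
      (f := fun z ↦ ψ z * character (ξ k) z)
      ((ψ.contDiff.mul (contDiff_character _)).contDiffAt.of_le (mod_cast le_top))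
    simp only [smul_eq_mul] at h1
    rw [h1, norm_smul]
    refine (mul_le_mul_of_nonneg_left (norm_iteratedFDeriv_mul_character_le ψ.contDiff hA0
      (fun n hn ↦ hA n hn z) (ξ k) hn) (norm_nonneg _)).trans_eq ?_
    simp only [w]
    ring
  -- The remainder after finitely many terms is itself a test function, equal to the tail of the
  -- series. Its derivatives up to order `m` are bounded by the tail of `w`, so the finite order of
  -- `f` bounds the error.
  have key : ∀ s : Finset κ, ‖pairing f (mulSmooth ψ g hg) - ∑ k ∈ s, c k * pairing f (e k)‖
      ≤ C * ∑' k : {k // k ∉ s}, w k := by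
    intro s
    let r : 𝓓(X, ℂ) := mulSmooth ψ g hg - ∑ k ∈ s, c k • e k
    have hr : pairing f r = pairing f (mulSmooth ψ g hg) - ∑ k ∈ s, c k * pairing f (e k) := by
      have : pairingLM f r = pairingLM f (mulSmooth ψ g hg) - ∑ k ∈ s, c k * pairingLM f (e k) := by
        simp [r, map_sub, map_sum]
      exact this
    have hrz : ∀ z, r z = ψ z * g z - ∑ k ∈ s, c k * (ψ z * character (ξ k) z) := fun z ↦ by
      simp [r, e]
    have hrt : (r : Rd d → ℂ) = fun z ↦ ∑' k : {k // k ∉ s}, c k * (ψ z * character (ξ k) z) := by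
      funext z
      rw [hrz]
      have h1 : HasSum (fun k ↦ c k * (ψ z * character (ξ k) z)) (ψ z * g z) := by
        by_cases hz : ψ z = 0
        · simp [hz, hasSum_zero]
        · simpa only [mul_left_comm] using (hsum z hz).mul_left (ψ z)
      exact (((Finset.hasSum_compl_iff (f := fun k ↦ c k * (ψ z * character (ξ k) z)) s).2
        (by rwa [sub_add_cancel])).tsum_eq).symm
    rw [← hr]
    have hws : Summable fun k : {k // k ∉ s} ↦ w k := hw.subtype _
    refine hC r ?_ _ (tsum_nonneg fun k ↦ by positivity) fun n hn z ↦ ?_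
    · refine closure_mono fun z hz ↦ ?_
      contrapose! hz
      simp only [Function.mem_support, not_not] at hz ⊢
      simp [hrz, hz]
    · rw [hrt, iteratedFDeriv_tsum_apply (N := (m : ℕ∞))
        (v := fun _ (k : {k // k ∉ s}) ↦ w k)
        (fun k ↦ (hcont k).of_le (mod_cast le_top)) (fun _ _ ↦ hws)
        (fun n k z hn ↦ hbd k n (mod_cast hn) z) (mod_cast hn)]
      exact tsum_of_norm_bounded hws.hasSum fun k ↦ hbd k n hn z
  rw [HasSum, SummationFilter.unconditional_filter, tendsto_iff_norm_sub_tendsto_zero]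
  refine squeeze_zero (fun _ ↦ norm_nonneg _) (fun s ↦ (norm_sub_rev _ _).trans_le (key s)) ?_
  simpa using (tendsto_tsum_compl_atTop_zero w).const_mul C

/-- Finite order of `f` costs `m` derivatives, and each derivative of the character costs a factor
`|ξ|`. -/
theorem exists_norm_fourier_le (f : 𝓓'(X, ℂ)) (χ : 𝓓(X, ℂ)) :
    ∃ (C : ℝ) (m : ℕ), 0 ≤ C ∧ ∀ ξ, ‖fourier f χ ξ‖ ≤ C * (1 + ‖ξ‖) ^ m := by
  obtain ⟨C, m, hC0, hC⟩ := exists_norm_pairing_le f ⟨tsupport χ, χ.hasCompactSupport⟩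
    χ.tsupport_subset
  obtain ⟨A, hA0, hA⟩ := exists_norm_iteratedFDeriv_le χ m
  refine ⟨‖(((2 * Real.pi) ^ (-(d : ℝ) / 2) : ℝ) : ℂ)‖ * (C * (2 ^ m * A)), m, by positivity,
    fun ξ ↦ ?_⟩
  rw [fourier, norm_mul, mul_assoc, mul_assoc]
  refine mul_le_mul_of_nonneg_left ?_ (norm_nonneg _)
  refine hC _ tsupport_mul_subset_left _ (by positivity) fun n hn z ↦ ?_
  exact norm_iteratedFDeriv_mul_character_le χ.contDiff hA0 (fun n hn ↦ hA n hn z) ξ hn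

end Pairing

/-! ### Expansions in characters with controlled coefficients -/

section Expansion

open scoped FourierTransform

variable {d : ℕ} {X : Opens (Rd d)}

theorem norm_lat (ε : ℝ) (k : Fin d → ℤ) : ‖lat ε k‖ = |ε| * ‖lat 1 k‖ := by
  rw [lat_eq_smul, norm_smul, Real.norm_eq_abs]

theorem lat_one_eq_zero {k : Fin d → ℤ} (h : lat 1 k = 0) : k = 0 := by
  funext i
  have := congrArg (fun v : Rd d ↦ v i) h
  simpa [lat_apply] using this

theorem summable_norm_lat_inv_pow {N : ℕ} (hN : d < N) :
    Summable fun k : Fin d → ℤ ↦ ‖lat 1 k‖⁻¹ ^ N := by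
  let b : Module.Basis (Fin d) ℝ (Rd d) := (EuclideanSpace.basisFun (Fin d) ℝ).toBasis
  let bz := b.restrictScalars ℤ
  have hrank : Module.finrank ℤ (Submodule.span ℤ (Set.range b)) = d := by
    simpa using Module.finrank_eq_card_basis bz
  have h := ZLattice.summable_norm_pow_inv (Submodule.span ℤ (Set.range b)) N (by rwa [hrank])
  have h2 := (bz.equivFun.symm.toEquiv.summable_iff).2 h
  refine h2.congr fun k ↦ ?_
  have : ((bz.equivFun.symm k : Submodule.span ℤ (Set.range b)) : Rd d) = lat 1 k := by
    rw [Module.Basis.equivFun_symm_apply, Submodule.coe_sum]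
    ext i
    simp only [Submodule.coe_smul, bz, Module.Basis.restrictScalars_apply]
    simp [b, lat_apply, Finset.sum_apply, Pi.single_apply]
  simp only [Function.comp_apply]
  rw [← this]
  rfl

theorem summable_one_add_norm_lat {ε : ℝ} (hε : ε ≠ 0) {N : ℕ} (hN : d < N) :
    Summable fun k : Fin d → ℤ ↦ ((1 + ‖lat ε k‖) ^ N)⁻¹ := by
  classical
  -- At `k = 0` the term `‖lat 1 0‖⁻¹ ^ N` is `0`, so the origin is covered by an extra finitely
  -- supported term.
  have h1 := ((summable_norm_lat_inv_pow hN).mul_left ((|ε| ^ N)⁻¹)).add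
    (summable_of_hasFiniteSupport (f := fun k : Fin d → ℤ ↦ if k = 0 then (1 : ℝ) else 0)
      ((Set.finite_singleton 0).subset fun k hk ↦ by simpa using hk))
  refine h1.of_nonneg_of_le (fun k ↦ by positivity) fun k ↦ ?_
  by_cases hk : k = 0
  · have : ((1 + ‖lat ε k‖) ^ N)⁻¹ ≤ 1 :=
      inv_le_one_of_one_le₀ (one_le_pow₀ (by linarith [norm_nonneg (lat ε k)]))
    simp only [hk, if_true] at this ⊢
    have : 0 ≤ (|ε| ^ N)⁻¹ * ‖(lat 1 0 : Rd d)‖⁻¹ ^ N := by positivity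
    linarith
  · simp only [hk, if_false, add_zero]
    have h0 : 0 < ‖lat 1 k‖ := norm_pos_iff.2 fun h ↦ hk (lat_one_eq_zero h)
    rw [inv_pow, ← mul_inv, ← mul_pow, ← norm_lat]
    have : 0 < ‖lat ε k‖ := by rw [norm_lat]; positivity
    gcongr
    linarith

/-- The Fourier transform of a product of a fixed test function with a smooth function is rapidly
decreasing, with bounds in terms of the derivatives of the smooth function. -/
theorem exists_fourier_mul_le {χ₁ : Rd d → ℂ} (hχ : ContDiff ℝ (⊤ : ℕ∞) χ₁)
    (hχc : HasCompactSupport χ₁) (N : ℕ) :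
    ∃ (C : ℝ) (m : ℕ), 0 ≤ C ∧ ∀ g : Rd d → ℂ, ContDiff ℝ (⊤ : ℕ∞) g → ∀ B : ℝ, 0 ≤ B →
      (∀ n ≤ m, ∀ z ∈ tsupport χ₁, ‖iteratedFDeriv ℝ n g z‖ ≤ B) →
      ∀ w, (1 + ‖w‖) ^ N * ‖𝓕 (fun z ↦ χ₁ z * g z) w‖ ≤ C * B := by
  let q : Seminorm ℝ 𝓢(Rd d, ℂ) :=
    (Finset.Iic (N, 0)).sup fun m ↦ SchwartzMap.seminorm ℝ m.1 m.2
  have hq : Continuous q :=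
    Seminorm.continuous_finsetSup fun m _ ↦
      (schwartz_withSeminorms ℝ (Rd d) ℂ).continuous_seminorm m
  -- Continuity of the Fourier transform on `𝓢` bounds the weighted sup norm by finitely many
  -- Schwartz seminorms of `χ₁ g`; `m` and `p` are the largest derivative order and power among
  -- them.
  obtain ⟨s, C, -, hC⟩ := Seminorm.bound_of_continuous (schwartz_withSeminorms ℝ (Rd d) ℂ)
    (q.comp (SchwartzMap.fourierTransformCLM ℝ (V := Rd d) (E := ℂ)).toLinearMap)
    (hq.comp (SchwartzMap.fourierTransformCLM ℝ).continuous)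
  set m := s.sup Prod.snd
  set p := s.sup Prod.fst
  obtain ⟨ρ, hρ⟩ := hχc.isBounded.exists_norm_le
  obtain ⟨A, hA0, hA⟩ := exists_norm_iteratedFDeriv_le
    (X := (⊤ : Opens (Rd d))) ⟨χ₁, hχ, hχc, fun _ _ ↦ trivial⟩ m
  refine ⟨2 ^ N * (C * ((1 + |ρ|) ^ p * (2 ^ m * A))), m, by positivity, fun g hg B hB0 hB w ↦ ?_⟩
  have hcs : HasCompactSupport fun z ↦ χ₁ z * g z := hχc.mul_right
  let ψ : 𝓢(Rd d, ℂ) := hcs.toSchwartzMap (hχ.mul hg)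
  have hψ : (ψ : Rd d → ℂ) = fun z ↦ χ₁ z * g z := rfl
  have h1 := SchwartzMap.one_add_le_sup_seminorm_apply (𝕜 := ℝ) (m := (N, 0)) (k := N) (n := 0)
    le_rfl le_rfl (𝓕 ψ) w
  rw [norm_iteratedFDeriv_zero, SchwartzMap.fourier_coe, hψ] at h1
  refine h1.trans ?_
  simp only [mul_assoc]
  refine mul_le_mul_of_nonneg_left ?_ (by positivity)
  refine (hC ψ).trans ?_
  rw [smul_apply, NNReal.smul_def, smul_eq_mul]
  refine mul_le_mul_of_nonneg_left ?_ C.2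
  refine Seminorm.finset_sup_apply_le (by positivity) fun i hi ↦ ?_
  refine SchwartzMap.seminorm_le_bound ℝ _ _ _ (by positivity) fun z ↦ ?_
  have hi2 : i.2 ≤ m := Finset.le_sup (f := Prod.snd) hi
  have hi1 : i.1 ≤ p := Finset.le_sup (f := Prod.fst) hi
  by_cases hz : z ∈ tsupport χ₁
  · have h2 : ‖iteratedFDeriv ℝ i.2 ψ z‖ ≤ 2 ^ i.2 * (A * B) :=
      norm_iteratedFDeriv_mul_le_of_le hχ hg hA0 (fun n hn ↦ hA n (hn.trans hi2) z)
        fun n hn ↦ hB n (hn.trans hi2) z hz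
    have h3 : ‖z‖ ^ i.1 ≤ (1 + |ρ|) ^ p :=
      calc ‖z‖ ^ i.1 ≤ (1 + |ρ|) ^ i.1 := by
            gcongr; linarith [hρ z hz, le_abs_self ρ]
        _ ≤ _ := pow_le_pow_right₀ (by linarith [abs_nonneg ρ]) hi1
    have h4 : (2 : ℝ) ^ i.2 ≤ 2 ^ m := pow_le_pow_right₀ (by norm_num) hi2
    calc ‖z‖ ^ i.1 * ‖iteratedFDeriv ℝ i.2 ψ z‖ ≤ (1 + |ρ|) ^ p * (2 ^ i.2 * (A * B)) := by gcongr
      _ ≤ (1 + |ρ|) ^ p * (2 ^ m * (A * B)) := by gcongr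
  · have : iteratedFDeriv ℝ i.2 ψ z = 0 := by
      by_contra h
      exact hz (tsupport_mul_subset_left (f := χ₁) (g := g)
        (support_iteratedFDeriv_subset (𝕜 := ℝ) i.2 (f := ψ) h))
    rw [this]
    simp only [norm_zero, mul_zero]
    positivity

/-- Expansion in a Fourier series inside the pairing with a distribution: near the support of
`χ`, every smooth function `g` is a sum of characters `exp (-i ⟨·, ε k⟩)` with coefficients `c g k`
whose decay is controlled by the derivatives of `g` on a compact set. -/
theorem exists_expansion (f : 𝓓'(X, ℂ)) (χ : 𝓓(X, ℂ)) :
    ∃ (ε : ℝ) (K : Set (Rd d)) (c : (Rd d → ℂ) → (Fin d → ℤ) → ℂ), ε ≠ 0 ∧ IsCompact K ∧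
      (∀ ψ : 𝓓(X, ℂ), (∀ z, ψ z ≠ 0 → χ z ≠ 0) → ∀ (g : Rd d → ℂ) (hg : ContDiff ℝ (⊤ : ℕ∞) g),
        HasSum (fun k ↦ c g k * pairing f (mulSmooth ψ (character (lat ε k))
          (contDiff_character _))) (pairing f (mulSmooth ψ g hg))) ∧
      (∀ N : ℕ, ∃ (C : ℝ) (m : ℕ), 0 ≤ C ∧ ∀ g : Rd d → ℂ, ContDiff ℝ (⊤ : ℕ∞) g →
        ∀ B : ℝ, 0 ≤ B → (∀ n ≤ m, ∀ z ∈ K, ‖iteratedFDeriv ℝ n g z‖ ≤ B) →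
          ∀ k, ‖c g k‖ ≤ C * B * ((1 + ‖lat ε k‖) ^ N)⁻¹) ∧
      (∀ G : Rd d × Rd d → Rd d → ℂ, Continuous (Function.uncurry G) →
        ∀ k, Measurable fun p ↦ c (G p) k) := by
  obtain ⟨R₀, hR₀⟩ := χ.hasCompactSupport.isBounded.exists_norm_le
  -- The cutoff `χ₁` equals 1 on the ball of radius `R`, which contains the support of `χ`, and
  -- vanishes outside radius `R + 1`; the period `L` exceeds the diameter of the latter ball.
  set R : ℝ := |R₀| + 1
  have hR : 0 < R := by positivity
  let β : ContDiffBump (0 : Rd d) := ⟨R, R + 1, hR, by linarith⟩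
  let χ₁ : Rd d → ℂ := fun z ↦ ((β z : ℝ) : ℂ)
  have hχ₁ : ContDiff ℝ (⊤ : ℕ∞) χ₁ := Complex.ofRealCLM.contDiff.comp β.contDiff
  have hχ₁c : HasCompactSupport χ₁ := β.hasCompactSupport.comp_left (g := Complex.ofReal) rfl
  set L : ℝ := 2 * (R + 1) + 1
  have hL : 0 < L := by positivity
  -- The coefficients depend on `g` only, so one choice serves every `ψ` living where `χ ≠ 0`, in
  -- particular `χ` times a character or a window.
  let c : (Rd d → ℂ) → (Fin d → ℤ) → ℂ := fun g k ↦
    ((L : ℂ) ^ d)⁻¹ * 𝓕 (fun z ↦ χ₁ z * g z) (lat L⁻¹ k)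
  have hε : -2 * Real.pi / L ≠ 0 := by
    have := Real.pi_pos
    exact div_ne_zero (by nlinarith) hL.ne'
  have hdecay : ∀ N : ℕ, ∃ (C : ℝ) (m : ℕ), 0 ≤ C ∧ ∀ g : Rd d → ℂ, ContDiff ℝ (⊤ : ℕ∞) g →
      ∀ B : ℝ, 0 ≤ B → (∀ n ≤ m, ∀ z ∈ tsupport χ₁, ‖iteratedFDeriv ℝ n g z‖ ≤ B) →
        ∀ k, ‖c g k‖ ≤ C * B * ((1 + ‖lat (-2 * Real.pi / L) k‖) ^ N)⁻¹ := by
    intro N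
    obtain ⟨C, m, hC0, hC⟩ := exists_fourier_mul_le hχ₁ hχ₁c N
    refine ⟨(L ^ d)⁻¹ * (2 * Real.pi) ^ N * C, m, by positivity, fun g hg B hB0 hB k ↦ ?_⟩
    have h1 := hC g hg B hB0 hB (lat L⁻¹ k)
    have h2 : 1 + ‖lat (-2 * Real.pi / L) k‖ ≤ 2 * Real.pi * (1 + ‖lat L⁻¹ k‖) := by
      rw [norm_lat, norm_lat L⁻¹, abs_div, abs_mul, abs_neg, abs_inv, abs_of_pos hL,
        abs_of_pos Real.pi_pos, abs_of_pos (two_pos : (0 : ℝ) < 2)]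
      have h3 : 1 ≤ 2 * Real.pi := by linarith [Real.pi_gt_three]
      calc _ ≤ 2 * Real.pi + 2 * Real.pi / L * ‖lat 1 k‖ := by gcongr
        _ = _ := by field_simp
    have h4 : ‖c g k‖ = (L ^ d)⁻¹ * ‖𝓕 (fun z ↦ χ₁ z * g z) (lat L⁻¹ k)‖ := by
      simp [c, abs_of_pos hL]
    rw [h4, ← div_eq_mul_inv, le_div_iff₀ (by positivity)]
    calc _ ≤ (L ^ d)⁻¹ * ‖𝓕 (fun z ↦ χ₁ z * g z) (lat L⁻¹ k)‖ *
          (2 * Real.pi * (1 + ‖lat L⁻¹ k‖)) ^ N := by gcongr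
      _ = (L ^ d)⁻¹ * (2 * Real.pi) ^ N *
          ((1 + ‖lat L⁻¹ k‖) ^ N * ‖𝓕 (fun z ↦ χ₁ z * g z) (lat L⁻¹ k)‖) := by
        rw [mul_pow]; ring
      _ ≤ (L ^ d)⁻¹ * (2 * Real.pi) ^ N * (C * B) := by gcongr
      _ = _ := by ring
  have hbound : ∀ g : Rd d → ℂ, ContDiff ℝ (⊤ : ℕ∞) g → ∀ m : ℕ, ∃ B : ℝ, 0 ≤ B ∧
      ∀ n ≤ m, ∀ z ∈ tsupport χ₁, ‖iteratedFDeriv ℝ n g z‖ ≤ B := by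
    intro g hg m
    have h1 : ∀ n, ∃ B : ℝ, ∀ z ∈ tsupport χ₁, ‖iteratedFDeriv ℝ n g z‖ ≤ B := fun n ↦
      IsCompact.exists_bound_of_continuousOn hχ₁c
        (hg.continuous_iteratedFDeriv (mod_cast le_top)).continuousOn
    choose B hB using h1
    refine ⟨∑ n ∈ Finset.range (m + 1), |B n|, Finset.sum_nonneg fun n _ ↦ abs_nonneg _,
      fun n hn z hz ↦ ((hB n z hz).trans (le_abs_self _)).trans ?_⟩
    exact Finset.single_le_sum (f := fun n ↦ |B n|) (fun n _ ↦ abs_nonneg _)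
      (Finset.mem_range.2 (Nat.lt_succ_of_le hn))
  have hsummable : ∀ g : Rd d → ℂ, ContDiff ℝ (⊤ : ℕ∞) g → ∀ n : ℕ,
      Summable fun k ↦ ‖c g k‖ * (1 + ‖lat (-2 * Real.pi / L) k‖) ^ n := by
    intro g hg n
    -- `n` powers absorb the weight, and `d + 1` make the lattice sum converge.
    obtain ⟨C, m, hC0, hC⟩ := hdecay (n + (d + 1))
    obtain ⟨B, hB0, hB⟩ := hbound g hg m
    refine ((summable_one_add_norm_lat hε (Nat.lt_succ_self d)).mul_left (C * B)).of_nonneg_of_le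
      (fun k ↦ by positivity) fun k ↦ ?_
    refine (mul_le_mul_of_nonneg_right (hC g hg B hB0 hB k) (by positivity)).trans_eq ?_
    rw [pow_add]
    field_simp
  refine ⟨-2 * Real.pi / L, tsupport χ₁, c, hε, hχ₁c, ?_, hdecay, ?_⟩
  · intro ψ hψ g hg
    refine hasSum_pairing_character f ψ hg (c g) _ (hsummable g hg) fun z hz ↦ ?_
    have hzR : ‖z‖ ≤ R := by
      have := hR₀ z (subset_closure (hψ z hz))
      simp only [R]
      linarith [le_abs_self R₀]
    have hz1 : χ₁ z = 1 := by
      simp only [χ₁]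
      rw [β.one_of_mem_closedBall (by simpa using hzR)]
      simp
    have h1 := hasSum_fourier_series (ψ := fun z ↦ χ₁ z * g z) (L := L) (R := R + 1)
      (by positivity) (by simp [L]) (hχ₁.continuous.mul hg.continuous)
      (fun w hw ↦ by
        have : β w = 0 := β.zero_of_le_dist (by simpa using hw.le)
        simp [χ₁, this])
      (by
        have h2 := (hsummable g hg 0).of_norm_bounded (f := c g) fun k ↦ by simp
        have h3 := h2.mul_left ((L : ℂ) ^ d)
        refine h3.congr fun k ↦ ?_
        have : (L : ℂ) ^ d ≠ 0 := pow_ne_zero _ (mod_cast hL.ne')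
        simp only [c]
        field_simp) (z := z) (hzR.trans (by linarith))
    simpa [hz1] using h1
  · intro G hG k
    simp only [c, fourier_eq_character]
    refine Measurable.const_mul ?_ _
    have h1 : Continuous fun q : (Rd d × Rd d) × Rd d ↦
        character ((2 * Real.pi) • lat L⁻¹ k) q.2 * (χ₁ q.2 * G q.1 q.2) :=
      ((contDiff_character _).continuous.comp continuous_snd).mul
        ((hχ₁.continuous.comp continuous_snd).mul hG)
    exact (h1.stronglyMeasurable.integral_prod_right (ν := volume)).measurable

end Expansion

/-! ### Membership in a BF-space and series of translates -/

section BF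

variable {V : Type*} [MeasureSpace V]
variable {𝓑 : Type*} [NormedAddCommGroup 𝓑] [NormedSpace ℂ 𝓑]
variable {ι : 𝓑 →ₗ[ℂ] (V →ₘ[volume] ℂ)}

/-- A function belongs to `𝓑`. -/
def MemBF (ι : 𝓑 →ₗ[ℂ] (V →ₘ[volume] ℂ)) (F : V → ℂ) : Prop :=
  ∃ b : 𝓑, ι b =ᵐ[volume] F

/-- The wave-front sets see only whether seminorms are finite, so it suffices to argue with
membership. -/
theorem bfNorm_lt_top_iff {F : V → ℂ} : bfNorm ι F < ∞ ↔ MemBF ι F := by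
  constructor
  · intro h
    by_contra hF
    refine h.ne ?_
    simp only [bfNorm, iInf_eq_top]
    exact fun b hb ↦ absurd ⟨b, hb⟩ hF
  · rintro ⟨b, hb⟩
    exact (iInf₂_le b hb).trans_lt enorm_lt_top

theorem MemBF.congr {F G : V → ℂ} (hF : MemBF ι F) (h : F =ᵐ[volume] G) : MemBF ι G :=
  hF.imp fun _ hb ↦ hb.trans h

theorem MemBF.aestronglyMeasurable {F : V → ℂ} (hF : MemBF ι F) :
    AEStronglyMeasurable F volume := by
  obtain ⟨b, hb⟩ := hF
  exact (ι b).aestronglyMeasurable.congr hb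

theorem MemBF.add {F G : V → ℂ} (hF : MemBF ι F) (hG : MemBF ι G) :
    MemBF ι fun p ↦ F p + G p := by
  obtain ⟨a, ha⟩ := hF
  obtain ⟨b, hb⟩ := hG
  refine ⟨a + b, ?_⟩
  rw [map_add]
  exact (AEEqFun.coeFn_add _ _).trans (ha.add hb)

theorem coeFn_sum_ae {κ : Type*} (t : Finset κ) (a : κ → 𝓑) :
    ι (∑ k ∈ t, a k) =ᵐ[volume] fun p ↦ ∑ k ∈ t, ι (a k) p := by
  classical
  induction t using Finset.induction_on with
  | empty =>
    simp only [Finset.sum_empty, map_zero]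
    exact AEEqFun.coeFn_zero
  | insert k t hk ih =>
    rw [Finset.sum_insert hk, map_add]
    filter_upwards [AEEqFun.coeFn_add (ι (a k)) (ι (∑ k ∈ t, a k)), ih] with p h1 h2
    rw [h1, Pi.add_apply, h2, Finset.sum_insert hk]

end BF

theorem IsModerateWeight.exists_le {V : Type*} [NormedAddCommGroup V] [MeasurableSpace V]
    {ω : V → ℝ} (hω : IsModerateWeight ω) :
    ∃ (C : ℝ) (N : ℕ), 0 ≤ C ∧ ∀ x y, ω (x + y) ≤ C * ω x * (1 + ‖y‖) ^ N := by
  obtain ⟨C, N, hC⟩ := hω.moderate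
  refine ⟨|C|, N, abs_nonneg C, fun x y ↦ (hC x y).trans ?_⟩
  have := (hω.pos x).le
  gcongr
  exact le_abs_self C

section BF

variable {V : Type*} [NormedAddCommGroup V] [NormedSpace ℝ V] [MeasureSpace V]
variable {𝓑 : Type*} [NormedAddCommGroup 𝓑] [NormedSpace ℂ 𝓑]
variable {ι : 𝓑 →ₗ[ℂ] (V →ₘ[volume] ℂ)} {v : V → ℝ}

theorem IsTranslationInvariantBFSpace.exists_solid (h : IsTranslationInvariantBFSpace ι v) :
    ∃ C : ℝ, 0 ≤ C ∧ ∀ (F : V → ℂ) (b : 𝓑), AEStronglyMeasurable F volume →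
      (∀ᵐ p, ‖F p‖ ≤ ‖ι b p‖) → ∃ a : 𝓑, ι a =ᵐ[volume] F ∧ ‖a‖ ≤ C * ‖b‖ := by
  obtain ⟨C, hC⟩ := h.solid
  refine ⟨|C|, abs_nonneg C, fun F b hF hle ↦ ?_⟩
  obtain ⟨a, ha, hab⟩ := hC (AEEqFun.mk F hF) b (by
    filter_upwards [AEEqFun.coeFn_mk F hF, hle] with p h1 h2
    rwa [h1])
  refine ⟨a, ha ▸ AEEqFun.coeFn_mk F hF, hab.trans ?_⟩
  gcongr
  exact le_abs_self C

theorem MemBF.of_norm_le (h : IsTranslationInvariantBFSpace ι v) {F G : V → ℂ} (hG : MemBF ι G)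
    (hF : AEStronglyMeasurable F volume) (hle : ∀ᵐ p, ‖F p‖ ≤ ‖G p‖) : MemBF ι F := by
  obtain ⟨C, -, hC⟩ := h.exists_solid
  obtain ⟨b, hb⟩ := hG
  obtain ⟨a, ha, -⟩ := hC F b hF (by filter_upwards [hb, hle] with p h1 h2; rwa [h1])
  exact ⟨a, ha⟩

theorem MemBF.norm (h : IsTranslationInvariantBFSpace ι v) {F : V → ℂ} (hF : MemBF ι F) :
    MemBF ι fun p ↦ ((‖F p‖ : ℝ) : ℂ) :=
  hF.of_norm_le h (Complex.continuous_ofReal.comp_aestronglyMeasurable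
    hF.aestronglyMeasurable.norm) (.of_forall fun p ↦ by simp)

/-- A measurable function dominated by an absolutely convergent countable series of elements of
`𝓑` belongs to `𝓑`. -/
theorem memBF_of_enorm_le_tsum (h : IsTranslationInvariantBFSpace ι v) {κ : Type*} [Countable κ]
    (b : κ → 𝓑) (hb : Summable fun k ↦ ‖b k‖) {F : V → ℂ} (hF : AEStronglyMeasurable F volume)
    (hle : ∀ᵐ p, ‖F p‖ₑ ≤ ∑' k, ‖ι (b k) p‖ₑ) : MemBF ι F := by
  obtain ⟨C, hC0, hC⟩ := h.exists_solid
  have := h.complete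
  choose a ha han using fun k ↦ hC (fun p ↦ ((‖ι (b k) p‖ : ℝ) : ℂ)) (b k)
    (Complex.continuous_ofReal.comp_aestronglyMeasurable (ι (b k)).aestronglyMeasurable.norm)
    (.of_forall fun p ↦ by simp)
  have hsa : Summable a := Summable.of_norm_bounded (hb.mul_left C) han
  set s := ∑' k, a k
  -- Convergence in norm is turned into a pointwise bound. The positive part `D` of `∑_{k ∈ t} |b_k|
  -- - Re s` is dominated by `|∑_{k ∈ t'} a_k - s|` for every `t' ⊇ t`. By solidity its norm is at
  -- most `C` times a quantity tending to 0, so `D = 0`.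
  have key : ∀ t : Finset κ, ∀ᵐ p, ∑ k ∈ t, ‖ι (b k) p‖ ≤ (ι s p).re := by
    intro t
    let D : V → ℂ := fun p ↦ ((max (∑ k ∈ t, ‖ι (b k) p‖ - (ι s p).re) 0 : ℝ) : ℂ)
    have hD : AEStronglyMeasurable D volume := by
      refine Complex.continuous_ofReal.comp_aestronglyMeasurable
        (AEStronglyMeasurable.sup (AEStronglyMeasurable.sub ?_ ?_) aestronglyMeasurable_const)
      · exact Finset.aestronglyMeasurable_fun_sum _ fun k _ ↦
          (ι (b k)).aestronglyMeasurable.norm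
      · exact Complex.continuous_re.comp_aestronglyMeasurable (ι s).aestronglyMeasurable
    have h1 : ∀ t' : Finset κ, t ⊆ t' → ∃ e : 𝓑, ι e =ᵐ[volume] D ∧
        ‖e‖ ≤ C * ‖∑ k ∈ t', a k - s‖ := by
      intro t' ht'
      refine hC D _ hD ?_
      have h2 : ∀ᵐ p, ∀ k : κ, ι (a k) p = ((‖ι (b k) p‖ : ℝ) : ℂ) := ae_all_iff.2 ha
      have h3 := AEEqFun.coeFn_sub (ι (∑ k ∈ t', a k)) (ι s)
      rw [← map_sub] at h3
      filter_upwards [h2, h3, coeFn_sum_ae (ι := ι) t' a] with p h2 h3 h4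
      rw [h3, Pi.sub_apply, h4, Complex.norm_real, Real.norm_eq_abs,
        abs_of_nonneg (le_max_right _ _)]
      refine max_le ?_ (norm_nonneg _)
      refine le_trans ?_ (Complex.re_le_norm _)
      simp only [h2, Complex.sub_re, Complex.re_sum, Complex.ofReal_re]
      gcongr
    obtain ⟨e, he, -⟩ := h1 t subset_rfl
    have h2 : ∀ᶠ t' in atTop, ‖e‖ ≤ C * ‖∑ k ∈ t', a k - s‖ := by
      filter_upwards [eventually_ge_atTop t] with t' ht'
      obtain ⟨e', he', hle'⟩ := h1 t' ht'
      have : e = e' := h.injective (AEEqFun.ext (he.trans he'.symm))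
      rwa [this]
    have h3 : Tendsto (fun t' : Finset κ ↦ C * ‖∑ k ∈ t', a k - s‖) atTop (𝓝 0) := by
      have := tendsto_iff_norm_sub_tendsto_zero.1 hsa.hasSum
      simpa using this.const_mul C
    have h4 : e = 0 := norm_le_zero_iff.1 (ge_of_tendsto h3 h2)
    rw [h4, map_zero] at he
    filter_upwards [he, AEEqFun.coeFn_zero (α := V) (μ := volume) (β := ℂ)] with p h5 h6
    rw [h6] at h5
    have h7 : max (∑ k ∈ t, ‖ι (b k) p‖ - (ι s p).re) 0 = 0 :=
      Complex.ofReal_eq_zero.1 h5.symm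
    linarith [le_max_left (∑ k ∈ t, ‖ι (b k) p‖ - (ι s p).re) 0]
  refine MemBF.of_norm_le h ⟨s, ae_eq_refl _⟩ hF ?_
  filter_upwards [hle, ae_all_iff.2 key] with p h1 h2
  rw [← enorm_le_iff_norm_le]
  refine h1.trans ?_
  rw [ENNReal.tsum_eq_iSup_sum]
  refine iSup_le fun t ↦ ?_
  have h3 : ∑ k ∈ t, ‖ι (b k) p‖ₑ = ENNReal.ofReal (∑ k ∈ t, ‖ι (b k) p‖) := by
    rw [ENNReal.ofReal_sum_of_nonneg fun _ _ ↦ norm_nonneg _]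
    simp only [ofReal_norm]
  rw [h3, ← ofReal_norm]
  exact ENNReal.ofReal_le_ofReal ((h2 t).trans (Complex.re_le_norm _))

/-- A measurable function dominated by a series of translates of an element of `𝓑`, with weights
that decrease fast enough, belongs to `𝓑`. -/
theorem exists_memBF_of_le_translates [MeasurableAdd V] [(volume : Measure V).IsAddRightInvariant]
    (h : IsTranslationInvariantBFSpace ι v) :
    ∃ N₀ : ℕ, ∀ (κ : Type) [Countable κ] (w : κ → ℝ) (t : κ → V), (∀ k, 0 ≤ w k) →
      (Summable fun k ↦ w k * (1 + ‖t k‖) ^ N₀) → ∀ F G : V → ℂ, MemBF ι G →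
      AEStronglyMeasurable F volume →
      (∀ p, ‖F p‖ₑ ≤ ∑' k, ENNReal.ofReal (w k) * ‖G (p - t k)‖ₑ) → MemBF ι F := by
  obtain ⟨C₁, N₀, hC₁0, hC₁⟩ := h.weight.toIsModerateWeight.exists_le
  obtain ⟨C₂, hC₂⟩ := h.translation
  refine ⟨N₀, fun κ _ w t hw hs F G ⟨b, hb⟩ hF hle ↦ ?_⟩
  choose b' hb' hbn using fun k ↦ hC₂ b (t k)
  have hv0 := (h.weight.pos 0).le
  have hbn' : ∀ k, ‖((w k : ℝ) : ℂ) • b' k‖ ≤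
      (|C₂| * (C₁ * v 0) * ‖b‖) * (w k * (1 + ‖t k‖) ^ N₀) := fun k ↦ by
    have h1 := hC₁ 0 (t k)
    rw [zero_add] at h1
    have hvk := (h.weight.pos (t k)).le
    have hwk := hw k
    rw [norm_smul, Complex.norm_real, Real.norm_eq_abs, abs_of_nonneg hwk]
    calc w k * ‖b' k‖ ≤ w k * (C₂ * v (t k) * ‖b‖) := by gcongr; exact hbn k
      _ ≤ w k * (|C₂| * (C₁ * v 0 * (1 + ‖t k‖) ^ N₀) * ‖b‖) := by
        gcongr
        exact le_abs_self C₂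
      _ = _ := by ring
  refine memBF_of_enorm_le_tsum h (fun k ↦ ((w k : ℝ) : ℂ) • b' k)
    ((hs.mul_left _).of_nonneg_of_le (fun _ ↦ norm_nonneg _) hbn') hF ?_
  have h1 : ∀ᵐ p, ∀ k, ι (((w k : ℝ) : ℂ) • b' k) p = (w k : ℂ) * G (p - t k) := by
    refine ae_all_iff.2 fun k ↦ ?_
    have h2 : ∀ᵐ p : V, ι b (p - t k) = G (p - t k) :=
      (measurePreserving_sub_right volume (t k)).quasiMeasurePreserving.ae hb
    have h3 := AEEqFun.coeFn_smul ((w k : ℝ) : ℂ) (ι (b' k))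
    rw [← map_smul] at h3
    filter_upwards [h2, h3, hb' k] with p h2 h3 h4
    rw [h3, Pi.smul_apply, h4, h2, smul_eq_mul]
  filter_upwards [h1] with p h1
  refine (hle p).trans_eq (tsum_congr fun k ↦ ?_)
  rw [h1 k, enorm_mul, ← ofReal_norm (w k : ℂ), Complex.norm_real, Real.norm_eq_abs,
    abs_of_nonneg (hw k)]

end BF

/-! ### Lattices as nets -/

section Lattice

variable {d : ℕ}

theorem exists_norm_sub_lat_le {r : ℝ} (hr : 0 < r) :
    ∃ δ : ℝ, δ ≠ 0 ∧ ∀ y : Rd d, ∃ k, ‖y - lat δ k‖ ≤ r := by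
  -- Rounding each coordinate leaves an error of norm at most `√d δ`; dividing by `d + 1` also keeps
  -- `δ` nonzero when `d = 0`.
  refine ⟨r / (d + 1), by positivity, fun y ↦ ⟨fun i ↦ round (y i / (r / (d + 1))), ?_⟩⟩
  set δ := r / (d + 1) with hδ
  have hδ0 : 0 < δ := by positivity
  have h1 : ∀ i, |(y - lat δ fun i ↦ round (y i / δ)) i| ≤ δ := fun i ↦ by
    have h2 := abs_sub_round (y i / δ)
    have h3 : (y - lat δ fun i ↦ round (y i / δ)) i = δ * (y i / δ - round (y i / δ)) := by
      simp [lat_apply]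
      field_simp
    rw [h3, abs_mul, abs_of_pos hδ0]
    nlinarith
  rw [EuclideanSpace.norm_eq]
  refine Real.sqrt_le_iff.2 ⟨hr.le, ?_⟩
  calc ∑ i, ‖(y - lat δ fun i ↦ round (y i / δ)) i‖ ^ 2 ≤ ∑ _i : Fin d, δ ^ 2 := by
        gcongr with i
        exact h1 i
    _ = d * δ ^ 2 := by simp
    _ ≤ (d + 1) ^ 2 * δ ^ 2 := by
      gcongr
      nlinarith [(Nat.cast_nonneg d : (0 : ℝ) ≤ d)]
    _ = r ^ 2 := by rw [hδ]; field_simp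

end Lattice

/-! ### Coverings by translates, and cones -/

section Covering

variable {d : ℕ} {𝓑 : Type*} [NormedAddCommGroup 𝓑] [NormedSpace ℂ 𝓑]
variable {ι : 𝓑 →ₗ[ℂ] (Rd d × Rd d →ₘ[volume] ℂ)} {v : Rd d × Rd d → ℝ}

instance isAddRightInvariant_volume_prod :
    (volume : Measure (Rd d × Rd d)).IsAddRightInvariant :=
  inferInstanceAs ((volume : Measure (Rd d)).prod (volume : Measure (Rd d))).IsAddRightInvariant

/-- The function `(1 + |y|)^{-N}`. -/
def decay (N : ℕ) (y : Rd d) : ℝ := ((1 + ‖y‖) ^ N)⁻¹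

theorem decay_pos (N : ℕ) (y : Rd d) : 0 < decay N y := by
  unfold decay; positivity

theorem continuous_decay (N : ℕ) : Continuous (decay (d := d) N) := by
  unfold decay
  exact Continuous.inv₀ (by fun_prop) fun y ↦ by positivity

theorem decay_add (M N : ℕ) (y : Rd d) : decay (M + N) y = decay M y * decay N y := by
  simp [decay, pow_add, mul_comm]

theorem pow_mul_decay (N : ℕ) (y : Rd d) : (1 + ‖y‖) ^ N * decay N y = 1 :=
  mul_inv_cancel₀ (by positivity)

theorem one_add_norm_add_le {E : Type*} [SeminormedAddCommGroup E] (x y : E) :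
    1 + ‖x + y‖ ≤ (1 + ‖x‖) * (1 + ‖y‖) := by
  nlinarith [norm_add_le x y, mul_nonneg (norm_nonneg x) (norm_nonneg y)]

/-- In a translation invariant BF-space, a function `F` which decays fast enough in the
direction of the coordinate `q` belongs to the space as soon as it is dominated by all the translates
of an element of the space that put `q` in a fixed ball. -/
theorem exists_memBF_of_covering (h : IsTranslationInvariantBFSpace ι v) :
    ∃ N : ℕ, ∀ (q : Rd d × Rd d → Rd d) (e : Rd d → Rd d × Rd d), (∀ y, ‖e y‖ ≤ ‖y‖) →
      ∀ (a : Rd d) (r C : ℝ), 0 < r → 0 ≤ C → ∀ F G : Rd d × Rd d → ℂ, MemBF ι G →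
        AEStronglyMeasurable F volume →
        (∀ p t, ‖q p - t - a‖ ≤ r → (1 + ‖q p‖) ^ N * ‖F p‖ ≤ C * ‖G (p - e t)‖) →
        MemBF ι F := by
  obtain ⟨N₀, hN₀⟩ := exists_memBF_of_le_translates h
  refine ⟨N₀ + (d + 1), fun q e he a r C hr hC F G hG hF hle ↦ ?_⟩
  -- `N₀` powers pay for the growth of `v` under translation, `d + 1` for summation over the
  -- lattice. Each point `p` needs only the single term with `lat δ k` within `r` of `q p - a`.
  set N := N₀ + (d + 1)
  obtain ⟨δ, hδ, hcov⟩ := exists_norm_sub_lat_le (d := d) hr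
  set D : ℝ := C * (1 + ‖a‖ + r) ^ N
  refine hN₀ (Fin d → ℤ) (fun k ↦ D * decay N (lat δ k)) (fun k ↦ e (lat δ k))
    (fun k ↦ mul_nonneg (by positivity) (decay_pos _ _).le) ?_ F G hG hF fun p ↦ ?_
  · refine ((summable_one_add_norm_lat hδ (Nat.lt_succ_self d)).mul_left D).of_nonneg_of_le
      (fun k ↦ mul_nonneg (mul_nonneg (by positivity) (decay_pos _ _).le) (by positivity))
      fun k ↦ ?_
    calc D * decay N (lat δ k) * (1 + ‖e (lat δ k)‖) ^ N₀
        ≤ D * decay N (lat δ k) * (1 + ‖lat δ k‖) ^ N₀ := by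
          have := (decay_pos N (lat δ k)).le
          gcongr
          exact he _
      _ = D * ((1 + ‖lat δ k‖) ^ N₀ * decay N₀ (lat δ k)) * decay (d + 1) (lat δ k) := by
          simp only [N]; rw [decay_add]; ring
      _ = _ := by rw [pow_mul_decay, mul_one]; rfl
  · obtain ⟨k, hk⟩ := hcov (q p - a)
    have h1 := hle p (lat δ k) (by rwa [sub_right_comm])
    have h2 : 1 + ‖lat δ k‖ ≤ (1 + ‖a‖ + r) * (1 + ‖q p‖) := by
      have h3 : ‖lat δ k‖ ≤ ‖q p‖ + ‖a‖ + r := by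
        have h4 : lat δ k = (q p - a) - (q p - a - lat δ k) := by abel
        rw [h4]
        exact (norm_sub_le _ _).trans (add_le_add (norm_sub_le _ _) hk)
      nlinarith [norm_nonneg a, norm_nonneg (q p), mul_nonneg (norm_nonneg a) (norm_nonneg (q p)),
        mul_nonneg hr.le (norm_nonneg (q p))]
    have h5 : ‖F p‖ ≤ D * decay N (lat δ k) * ‖G (p - e (lat δ k))‖ := by
      have h6 : (1 + ‖lat δ k‖) ^ N * ‖F p‖ ≤ D * ‖G (p - e (lat δ k))‖ :=
        calc _ ≤ ((1 + ‖a‖ + r) * (1 + ‖q p‖)) ^ N * ‖F p‖ := by gcongr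
          _ = (1 + ‖a‖ + r) ^ N * ((1 + ‖q p‖) ^ N * ‖F p‖) := by rw [mul_pow]; ring
          _ ≤ (1 + ‖a‖ + r) ^ N * (C * ‖G (p - e (lat δ k))‖) := by gcongr
          _ = _ := by simp only [D]; ring
      rw [decay, mul_right_comm, ← div_eq_mul_inv, le_div_iff₀ (by positivity)]
      linarith
    refine le_trans ?_ (ENNReal.le_tsum k)
    rw [← ofReal_norm, ← ofReal_norm,
      ← ENNReal.ofReal_mul (mul_nonneg (by positivity) (decay_pos _ _).le)]
    exact ENNReal.ofReal_le_ofReal h5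

theorem MemBF.of_schwartz (h : IsTranslationInvariantBFSpace ι v) (s : 𝓢(Rd d × Rd d, ℂ)) :
    MemBF ι s := by
  obtain ⟨j, hj⟩ := h.schwartz_embedding
  exact ⟨j s, hj s⟩

theorem norm_ofReal_decay (N : ℕ) (y : Rd d) : ‖((decay N y : ℝ) : ℂ)‖ = decay N y := by
  rw [Complex.norm_real, Real.norm_eq_abs, abs_of_pos (decay_pos _ _)]

/-- For `N` large enough, functions in `𝓑` can be smeared out to decay of order `N`, and `𝓑`
contains a function which decays exactly to the order `N`. -/
theorem exists_memBF_decay (h : IsTranslationInvariantBFSpace ι v) :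
    ∃ N : ℕ, (∀ (q : Rd d × Rd d → Rd d) (e : Rd d → Rd d × Rd d), (∀ y, ‖e y‖ ≤ ‖y‖) →
      ∀ (a : Rd d) (r C : ℝ), 0 < r → 0 ≤ C → ∀ F G : Rd d × Rd d → ℂ, MemBF ι G →
        AEStronglyMeasurable F volume →
        (∀ p t, ‖q p - t - a‖ ≤ r → (1 + ‖q p‖) ^ N * ‖F p‖ ≤ C * ‖G (p - e t)‖) →
        MemBF ι F) ∧
      MemBF ι fun p ↦ (decay N p.1 : ℂ) * (decay N p.2 : ℂ) := by
  obtain ⟨N, hN⟩ := exists_memBF_of_covering h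
  -- A tensor product of bumps lies in `𝓢`, hence in `𝓑`; it is smeared out first in one variable,
  -- then in the other.
  refine ⟨N, hN, ?_⟩
  let β : ContDiffBump (0 : Rd d) := ⟨1, 2, one_pos, one_lt_two⟩
  have hβ1 : ∀ y : Rd d, ‖y‖ ≤ 1 → β y = 1 := fun y hy ↦
    β.one_of_mem_closedBall (by simpa using hy)
  let G₀ : Rd d × Rd d → ℂ := fun p ↦ ((β p.1 : ℝ) : ℂ) * ((β p.2 : ℝ) : ℂ)
  have hβc : Continuous fun y : Rd d ↦ ((β y : ℝ) : ℂ) :=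
    Complex.continuous_ofReal.comp β.continuous
  have hdc : Continuous fun y : Rd d ↦ ((decay N y : ℝ) : ℂ) :=
    Complex.continuous_ofReal.comp (continuous_decay N)
  have hG₀s : ContDiff ℝ (⊤ : ℕ∞) G₀ :=
    (Complex.ofRealCLM.contDiff.comp (β.contDiff.comp contDiff_fst)).mul
      (Complex.ofRealCLM.contDiff.comp (β.contDiff.comp contDiff_snd))
  have hG₀c : HasCompactSupport G₀ := by
    refine HasCompactSupport.intro (β.hasCompactSupport.isCompact.prod
      β.hasCompactSupport.isCompact) fun p hp ↦ ?_
    rw [mem_prod, not_and_or] at hp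
    rcases hp with hp | hp <;> simp [G₀, image_eq_zero_of_notMem_tsupport hp]
  have h0 : MemBF ι G₀ := MemBF.of_schwartz h (hG₀c.toSchwartzMap hG₀s)
  have h1 : MemBF ι fun p ↦ (decay N p.1 : ℂ) * ((β p.2 : ℝ) : ℂ) := by
    refine hN Prod.fst (fun y ↦ (y, 0)) (fun y ↦ by simp) 0 1 1 one_pos zero_le_one _ G₀ h0
      ((hdc.comp continuous_fst).mul (hβc.comp continuous_snd)).aestronglyMeasurable
      fun p t hpt ↦ ?_
    simp only [G₀, Prod.fst_sub, Prod.snd_sub, sub_zero] at hpt ⊢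
    rw [hβ1 _ hpt, norm_mul, norm_ofReal_decay, ← mul_assoc, pow_mul_decay]
    simp
  refine hN Prod.snd (fun y ↦ (0, y)) (fun y ↦ by simp) 0 1 1 one_pos zero_le_one _ _ h1
    ((hdc.comp continuous_fst).mul (hdc.comp continuous_snd)).aestronglyMeasurable
    fun p t hpt ↦ ?_
  simp only [Prod.fst_sub, Prod.snd_sub, sub_zero] at hpt ⊢
  rw [hβ1 _ hpt, norm_mul, norm_ofReal_decay, norm_ofReal_decay, mul_left_comm, pow_mul_decay,
    norm_mul, norm_ofReal_decay]
  simp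

/-- Open cones can be shrunk around a given direction so that the smaller cone stays away from the
complement of the larger one. -/
theorem IsOpenCone.exists_shrink {Γ : Set (Rd d)} (hΓ : IsOpenCone Γ) {ξ₀ : Rd d} (hξ₀ : ξ₀ ∈ Γ) :
    ∃ (Γ' : Set (Rd d)) (A : ℝ), IsOpenCone Γ' ∧ ξ₀ ∈ Γ' ∧ 0 ≤ A ∧
      ∀ ξ ∈ Γ', ∀ η ∉ Γ, 1 + ‖η‖ ≤ A * (1 + ‖ξ - η‖) := by
  have hne : ξ₀ ≠ 0 := fun h0 ↦ hΓ.zero_notMem (h0 ▸ hξ₀)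
  have hn0 : 0 < ‖ξ₀‖ := norm_pos_iff.2 hne
  set u := ‖ξ₀‖⁻¹ • ξ₀ with hu
  have huΓ : u ∈ Γ := hΓ.smul_mem _ (by positivity) _ hξ₀
  obtain ⟨ρ, hρ, hball⟩ := Metric.isOpen_iff.1 hΓ.isOpen u huΓ
  set r := ρ / 2
  have hr : 0 < r := by positivity
  -- `Γ'` consists of the directions within `r = ρ / 2` of `u`. Rescaling by `|ξ|⁻¹` gives `|ξ| ≤
  -- r⁻¹ |ξ - η|`, hence `|η| ≤ (1 + r⁻¹) |ξ - η|`, which yields the constant.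
  refine ⟨{ξ | ξ ≠ 0 ∧ ‖‖ξ‖⁻¹ • ξ - u‖ < r}, 1 + (1 + r⁻¹), ⟨?_, ?_, ?_⟩, ⟨hne, ?_⟩,
    by positivity, ?_⟩
  · have : {ξ : Rd d | ξ ≠ 0 ∧ ‖‖ξ‖⁻¹ • ξ - u‖ < r} =
        {ξ : Rd d | ξ ≠ 0} ∩ (fun ξ : Rd d ↦ ‖‖ξ‖⁻¹ • ξ - u‖) ⁻¹' Iio r := rfl
    rw [this]
    refine ContinuousOn.isOpen_inter_preimage ?_ isOpen_ne isOpen_Iio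
    refine ContinuousOn.norm (ContinuousOn.sub (ContinuousOn.fun_smul ?_ continuousOn_id)
      continuousOn_const)
    exact ContinuousOn.inv₀ continuous_norm.continuousOn fun ξ hξ ↦ norm_ne_zero_iff.2 hξ
  · simp
  · rintro t ht ξ ⟨h1, h2⟩
    refine ⟨smul_ne_zero ht.ne' h1, ?_⟩
    rwa [norm_smul, Real.norm_eq_abs, abs_of_pos ht, smul_smul, mul_inv, mul_right_comm,
      inv_mul_cancel₀ ht.ne', one_mul]
  · simpa [← hu] using hr
  · rintro ξ ⟨h1, h2⟩ η hη
    have hξ : 0 < ‖ξ‖ := norm_pos_iff.2 h1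
    have h3 : ρ ≤ ‖‖ξ‖⁻¹ • η - u‖ := by
      by_contra! hlt
      have h4 : ‖ξ‖⁻¹ • η ∈ Γ := hball (by rwa [Metric.mem_ball, dist_eq_norm])
      have h5 := hΓ.smul_mem ‖ξ‖ hξ _ h4
      rw [smul_smul, mul_inv_cancel₀ hξ.ne', one_smul] at h5
      exact hη h5
    have h4 : r ≤ ‖ξ‖⁻¹ * ‖ξ - η‖ := by
      have h5 : ‖ξ‖⁻¹ • η - u = (‖ξ‖⁻¹ • ξ - u) - ‖ξ‖⁻¹ • (ξ - η) := by
        rw [smul_sub]; abel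
      have h6 := norm_sub_le (‖ξ‖⁻¹ • ξ - u) (‖ξ‖⁻¹ • (ξ - η))
      rw [← h5, norm_smul, norm_inv, norm_norm] at h6
      have : r + r = ρ := by simp [r]
      linarith
    have h5 : ‖ξ‖ ≤ r⁻¹ * ‖ξ - η‖ := by
      rw [inv_mul_eq_div, le_div_iff₀ hξ] at h4
      rw [inv_mul_eq_div, le_div_iff₀ hr]
      linarith
    have h6 : ‖η‖ ≤ ‖ξ‖ + ‖ξ - η‖ := by
      have := norm_sub_le ξ (ξ - η)
      rwa [sub_sub_cancel] at this
    have : 0 < r⁻¹ := by positivity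
    nlinarith [norm_nonneg (ξ - η)]

/-- Let `H` have polynomial growth, and belong to `𝓑` in the directions of a cone `Γ`. Then
functions supported in the directions of a smaller cone and dominated by rapidly convergent series of
translates of `H` in the second variable belong to `𝓑`. -/
theorem memBF_of_le_cone (h : IsTranslationInvariantBFSpace ι v) {N : ℕ}
    (hN : MemBF ι fun p ↦ (decay N p.1 : ℂ) * (decay N p.2 : ℂ)) {Γ Γ' : Set (Rd d)} {A : ℝ}
    (hA : 0 ≤ A) (hΓΓ' : ∀ ξ ∈ Γ', ∀ η ∉ Γ, 1 + ‖η‖ ≤ A * (1 + ‖ξ - η‖)) {H : Rd d × Rd d → ℝ}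
    (hH0 : ∀ p, 0 ≤ H p) {C : ℝ} {m : ℕ} (hC : 0 ≤ C)
    (hHC : ∀ y η, H (y, η) ≤ C * decay N y * (1 + ‖η‖) ^ m)
    (hHΓ : MemBF ι ((univ ×ˢ Γ).indicator fun p ↦ (H p : ℂ))) {F : Rd d × Rd d → ℂ}
    (hF : AEStronglyMeasurable F volume) {ε : ℝ} (hε : ε ≠ 0)
    (hFH : ∀ M : ℕ, ∃ C' : ℝ, 0 ≤ C' ∧ ∀ y, ∀ ξ ∈ Γ', ‖F (y, ξ)‖ₑ ≤
      ∑' k, ENNReal.ofReal (C' * decay M (lat ε k) * H (y, ξ + lat ε k)))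
    (hFΓ : ∀ y, ∀ ξ ∉ Γ', F (y, ξ) = 0) : MemBF ι F := by
  obtain ⟨N₀, hN₀⟩ := exists_memBF_of_le_translates h
  -- Of the required decay, `m + N` is spent on comparing `H` with `G`, `N₀` on the translations and
  -- `d + 1` on summability.
  obtain ⟨C', hC'0, hC'⟩ := hFH (m + N + (N₀ + (d + 1)))
  let G : Rd d × Rd d → ℂ := fun p ↦
    (univ ×ˢ Γ).indicator (fun p ↦ (H p : ℂ)) p + (decay N p.1 : ℂ) * (decay N p.2 : ℂ)
  have hG : MemBF ι G := hHΓ.add hN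
  have hGn : ∀ p, ‖G p‖ = (univ ×ˢ Γ).indicator H p + decay N p.1 * decay N p.2 := fun p ↦ by
    have h1 : G p = (((univ ×ˢ Γ).indicator H p + decay N p.1 * decay N p.2 : ℝ) : ℂ) := by
      by_cases hp : p ∈ univ ×ˢ Γ <;> simp [G, hp]
    rw [h1, Complex.norm_real, Real.norm_eq_abs, abs_of_nonneg]
    exact add_nonneg (indicator_nonneg (fun p _ ↦ hH0 p) p)
      (mul_pos (decay_pos _ _) (decay_pos _ _)).le
  -- For `η ∈ Γ` the first summand of `G` already is `H`. For `η ∉ Γ` the growth of `H` is measured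
  -- against the second summand, and powers of `1 + |η|` become powers of `1 + |ξ - η|`.
  have hQ : ∀ y, ∀ ξ ∈ Γ', ∀ η,
      H (y, η) ≤ (1 + C * A ^ (m + N)) * (1 + ‖ξ - η‖) ^ (m + N) * ‖G (y, η)‖ := by
    intro y ξ hξ η
    rw [hGn]
    have hd := (mul_pos (decay_pos N y) (decay_pos N η)).le
    have h1 : 1 ≤ (1 + ‖ξ - η‖) ^ (m + N) := one_le_pow₀ (by linarith [norm_nonneg (ξ - η)])
    have h2 : 0 ≤ C * A ^ (m + N) := by positivity
    by_cases hη : η ∈ Γ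
    · have hp : (y, η) ∈ univ ×ˢ Γ := ⟨trivial, hη⟩
      rw [indicator_of_mem hp]
      have h3 : 1 ≤ (1 + C * A ^ (m + N)) * (1 + ‖ξ - η‖) ^ (m + N) := by nlinarith
      nlinarith [hH0 (y, η)]
    · have hp : (y, η) ∉ univ ×ˢ Γ := fun hp ↦ hη hp.2
      rw [indicator_of_notMem hp, zero_add]
      calc H (y, η) ≤ C * decay N y * (1 + ‖η‖) ^ m := hHC y η
        _ = C * decay N y * (1 + ‖η‖) ^ m * ((1 + ‖η‖) ^ N * decay N η) := by
          rw [pow_mul_decay, mul_one]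
        _ = C * (1 + ‖η‖) ^ (m + N) * (decay N y * decay N η) := by rw [pow_add]; ring
        _ ≤ C * (A * (1 + ‖ξ - η‖)) ^ (m + N) * (decay N y * decay N η) := by
          gcongr
          exact hΓΓ' ξ hξ η hη
        _ = C * A ^ (m + N) * (1 + ‖ξ - η‖) ^ (m + N) * (decay N y * decay N η) := by
          rw [mul_pow]; ring
        _ ≤ _ := by gcongr; linarith
  set D := C' * (1 + C * A ^ (m + N))
  have hD : 0 ≤ D := by positivity
  refine hN₀ (Fin d → ℤ) (fun k ↦ D * decay (N₀ + (d + 1)) (lat ε k)) (fun k ↦ (0, -lat ε k))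
    (fun k ↦ mul_nonneg hD (decay_pos _ _).le) ?_ F G hG hF ?_
  · refine ((summable_one_add_norm_lat hε (Nat.lt_succ_self d)).mul_left D).congr fun k ↦ ?_
    rw [decay_add]
    simp only [Prod.norm_mk, norm_zero, norm_neg, norm_nonneg, sup_of_le_right]
    calc _ = D * decay (d + 1) (lat ε k) := rfl
      _ = D * ((1 + ‖lat ε k‖) ^ N₀ * decay N₀ (lat ε k)) * decay (d + 1) (lat ε k) := by
        rw [pow_mul_decay, mul_one]
      _ = _ := by ring
  · rintro ⟨y, ξ⟩
    by_cases hξ : ξ ∈ Γ'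
    · refine (hC' y ξ hξ).trans (ENNReal.tsum_le_tsum fun k ↦ ?_)
      rw [← ofReal_norm, ← ENNReal.ofReal_mul (mul_nonneg hD (decay_pos _ _).le)]
      refine ENNReal.ofReal_le_ofReal ?_
      have h1 := hQ y ξ hξ (ξ + lat ε k)
      rw [sub_add_cancel_left, norm_neg] at h1
      have h2 := mul_le_mul_of_nonneg_left h1
        (mul_nonneg hC'0 (decay_pos (m + N + (N₀ + (d + 1))) (lat ε k)).le)
      refine h2.trans_eq ?_
      simp only [Prod.mk_sub_mk, sub_zero, sub_neg_eq_add]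
      rw [decay_add (m + N)]
      calc _ = ((1 + ‖lat ε k‖) ^ (m + N) * decay (m + N) (lat ε k)) *
            (D * decay (N₀ + (d + 1)) (lat ε k) * ‖G (y, ξ + lat ε k)‖) := by
            simp only [D]; ring
        _ = _ := by rw [pow_mul_decay, one_mul]
    · rw [hFΓ y ξ hξ]
      simp

end Covering

/-! ### From the Fourier transform to the short-time Fourier transform -/

section Transforms

variable {d : ℕ} {X : Opens (Rd d)}

theorem mulSmooth_mulSmooth (χ : 𝓓(X, ℂ)) {a b c : Rd d → ℂ} (ha : ContDiff ℝ (⊤ : ℕ∞) a)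
    (hb : ContDiff ℝ (⊤ : ℕ∞) b) (hc : ContDiff ℝ (⊤ : ℕ∞) c)
    (h : ∀ z, χ z * (a z * b z) = χ z * c z) :
    mulSmooth (mulSmooth χ a ha) b hb = mulSmooth χ c hc := by
  ext z
  simp [mul_assoc, h]

theorem fourier_eq_pairing (f : 𝓓'(X, ℂ)) (χ : 𝓓(X, ℂ)) (ξ : Rd d) :
    fourier f χ ξ = (((2 * Real.pi) ^ (-(d : ℝ) / 2) : ℝ) : ℂ) *
      pairing f (mulSmooth χ (character ξ) (contDiff_character ξ)) := rfl

theorem stft_eq_pairing (ϕ : 𝓢(Rd d, ℂ)) (f : 𝓓'(X, ℂ)) (χ : 𝓓(X, ℂ)) (y ξ : Rd d) :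
    stft ϕ f χ (y, ξ) = (((2 * Real.pi) ^ (-(d : ℝ) / 2) : ℝ) : ℂ) *
      pairing f (mulSmooth χ (fun z ↦ conj (ϕ (z - y)) * character ξ z)
        (contDiff_window ϕ y ξ)) := rfl

/-- The pairing is a pointwise limit of finite sums in which `p` enters only through the measurable
coefficients. -/
theorem measurable_pairing (f : 𝓓'(X, ℂ)) (χ : 𝓓(X, ℂ)) (G : Rd d × Rd d → Rd d → ℂ)
    (hG : ∀ p, ContDiff ℝ (⊤ : ℕ∞) (G p)) (hGc : Continuous (Function.uncurry G)) :
    Measurable fun p ↦ pairing f (mulSmooth χ (G p) (hG p)) := by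
  obtain ⟨ε, K, c, -, -, hexp, -, hmeas⟩ := exists_expansion f χ
  refine measurable_of_tendsto_metrizable' (atTop : Filter (Finset (Fin d → ℤ)))
    (f := fun s p ↦ ∑ k ∈ s, c (G p) k * pairing f (mulSmooth χ (character (lat ε k))
      (contDiff_character _))) (fun s ↦ ?_) (tendsto_pi_nhds.2 fun p ↦ ?_)
  · exact Finset.measurable_fun_sum _ fun k _ ↦ (hmeas G hGc k).mul_const _
  · exact hexp χ (fun _ h ↦ h) (G p) (hG p)

theorem continuous_character_uncurry :
    Continuous fun q : Rd d × Rd d ↦ character q.1 q.2 := by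
  unfold character
  fun_prop

theorem measurable_stft (ϕ : 𝓢(Rd d, ℂ)) (f : 𝓓'(X, ℂ)) (χ : 𝓓(X, ℂ)) :
    Measurable (stft ϕ f χ) := by
  refine Measurable.const_mul (measurable_pairing f χ
    (fun p y ↦ conj (ϕ (y - p.1)) * character p.2 y) (fun p ↦ contDiff_window ϕ p.1 p.2) ?_) _
  refine Continuous.mul ?_ (continuous_character_uncurry.comp
    ((continuous_snd.comp continuous_fst).prodMk continuous_snd))
  exact Complex.continuous_conj.comp (ϕ.continuous.comp
    (continuous_snd.sub (continuous_fst.comp continuous_fst)))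

theorem measurable_fourier (f : 𝓓'(X, ℂ)) (χ : 𝓓(X, ℂ)) : Measurable (fourier f χ) := by
  have h1 := measurable_pairing f χ (fun p ↦ character p.2) (fun p ↦ contDiff_character p.2)
    (continuous_character_uncurry.comp
      ((continuous_snd.comp continuous_fst).prodMk continuous_snd))
  have h2 : Measurable fun ξ : Rd d ↦ ((0 : Rd d), ξ) := measurable_prodMk_left
  have h3 := (h1.comp h2).const_mul (((2 * Real.pi) ^ (-(d : ℝ) / 2) : ℝ) : ℂ)
  simp only [Function.comp_def] at h3
  have h4 : fourier f χ = fun ξ ↦ (((2 * Real.pi) ^ (-(d : ℝ) / 2) : ℝ) : ℂ) *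
      pairing f (mulSmooth χ (character ξ) (contDiff_character ξ)) :=
    funext (fourier_eq_pairing f χ)
  rw [h4]
  exact h3

theorem exists_norm_iteratedFDeriv_translate_le (s : 𝓢(Rd d, ℂ)) (N m : ℕ) :
    ∃ C : ℝ, 0 ≤ C ∧ ∀ y, ∀ n ≤ m, ∀ z,
      ‖iteratedFDeriv ℝ n (fun z ↦ s (z - y)) z‖ ≤ C * decay N (z - y) := by
  refine ⟨2 ^ N * (Finset.Iic (N, m)).sup (fun m ↦ SchwartzMap.seminorm ℝ m.1 m.2) s,
    by positivity, fun y n hn z ↦ ?_⟩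
  rw [iteratedFDeriv_comp_sub, decay, ← div_eq_mul_inv, le_div_iff₀ (by positivity), mul_comm]
  exact SchwartzMap.one_add_le_sup_seminorm_apply (m := (N, m)) le_rfl hn s (z - y)

/-- Peetre's inequality: this transfers the decay of the window to decay in `y` while `z` stays
bounded. -/
theorem decay_le_of_norm_le {ρ : ℝ} (N : ℕ) {y z : Rd d} (hz : ‖z‖ ≤ ρ) :
    decay N (z - y) ≤ (1 + ρ) ^ N * decay N y := by
  have h1 : 1 + ‖y‖ ≤ (1 + ρ) * (1 + ‖z - y‖) := by
    have h2 := one_add_norm_add_le z (y - z)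
    rw [add_sub_cancel, norm_sub_rev] at h2
    refine h2.trans ?_
    gcongr
  have h3 : (1 + ‖y‖) ^ N ≤ (1 + ρ) ^ N * (1 + ‖z - y‖) ^ N := by
    rw [← mul_pow]; gcongr
  unfold decay
  rw [← div_eq_mul_inv, inv_eq_one_div, div_le_div_iff₀ (by positivity) (by positivity)]
  linarith

theorem norm_iteratedFDeriv_conj (g : Rd d → ℂ) (n : ℕ) (z : Rd d) :
    ‖iteratedFDeriv ℝ n (fun z ↦ conj (g z)) z‖ = ‖iteratedFDeriv ℝ n g z‖ :=
  Complex.conjLIE.norm_iteratedFDeriv_comp_left g z n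

theorem contDiff_conj_translate (ϕ : 𝓢(Rd d, ℂ)) (y : Rd d) :
    ContDiff ℝ (⊤ : ℕ∞) fun z ↦ conj (ϕ (z - y)) :=
  Complex.conjCLE.contDiff.comp (ϕ.smooth'.comp (contDiff_id.sub contDiff_const))

theorem exists_norm_stft_le (ϕ : 𝓢(Rd d, ℂ)) (f : 𝓓'(X, ℂ)) (χ : 𝓓(X, ℂ)) :
    ∃ (C : ℝ) (m : ℕ), 0 ≤ C ∧ ∀ y ξ, ‖stft ϕ f χ (y, ξ)‖ ≤ C * (1 + ‖ξ‖) ^ m := by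
  obtain ⟨C, m, hC0, hC⟩ := exists_norm_pairing_le f ⟨tsupport χ, χ.hasCompactSupport⟩
    χ.tsupport_subset
  obtain ⟨A, hA0, hA⟩ := exists_norm_iteratedFDeriv_le χ m
  obtain ⟨B, hB0, hB⟩ := exists_norm_iteratedFDeriv_translate_le ϕ 0 m
  have hB' : ∀ y, ∀ n ≤ m, ∀ z, ‖iteratedFDeriv ℝ n (fun z ↦ conj (ϕ (z - y))) z‖ ≤ B :=
    fun y n hn z ↦ by
      rw [norm_iteratedFDeriv_conj]
      simpa [decay] using hB y n hn z
  refine ⟨‖(((2 * Real.pi) ^ (-(d : ℝ) / 2) : ℝ) : ℂ)‖ * (C * (2 ^ m * (2 ^ m * (A * B)))), m,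
    by positivity, fun y ξ ↦ ?_⟩
  rw [stft_eq_pairing, norm_mul, mul_assoc, mul_assoc]
  refine mul_le_mul_of_nonneg_left ?_ (norm_nonneg _)
  refine hC _ tsupport_mul_subset_left _ (by positivity) fun n hn z ↦ ?_
  have h1 : (mulSmooth χ (fun z ↦ conj (ϕ (z - y)) * character ξ z) (contDiff_window ϕ y ξ) :
      Rd d → ℂ) = fun z ↦ (χ z * conj (ϕ (z - y))) * character ξ z := by
    funext z; simp [mul_assoc]
  rw [h1]
  refine norm_iteratedFDeriv_mul_character_le (χ.contDiff.mul (contDiff_conj_translate ϕ y))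
    (by positivity) (fun n hn ↦ ?_) ξ hn
  refine (norm_iteratedFDeriv_mul_le_of_le χ.contDiff (contDiff_conj_translate ϕ y) hA0
    (fun i hi ↦ hA i (hi.trans hn) z) fun i hi ↦ hB' y i (hi.trans hn) z).trans ?_
  gcongr
  norm_num

theorem IsModerateWeight.exists_shift {ω : Rd d × Rd d → ℝ} (hω : IsModerateWeight ω) :
    ∃ (C : ℝ) (N : ℕ), 0 ≤ C ∧ ∀ y ξ x η,
      ω (y, ξ) ≤ C * ω (x, η) * ((1 + ‖y - x‖) ^ N * (1 + ‖ξ - η‖) ^ N) := by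
  obtain ⟨C, N, hC0, hC⟩ := hω.exists_le
  refine ⟨C, N, hC0, fun y ξ x η ↦ ?_⟩
  have h1 := hC (x, η) (y - x, ξ - η)
  simp only [Prod.mk_add_mk, add_sub_cancel] at h1
  refine h1.trans ?_
  have := (hω.pos (x, η)).le
  rw [← mul_pow]
  gcongr
  have h2 : ‖((y - x, ξ - η) : Rd d × Rd d)‖ ≤ ‖y - x‖ + ‖ξ - η‖ :=
    max_le_add_of_nonneg (norm_nonneg _) (norm_nonneg _)
  nlinarith [mul_nonneg (norm_nonneg (y - x)) (norm_nonneg (ξ - η))]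

theorem enorm_mul_le_tsum_of_hasSum {κ : Type*} {a : κ → ℂ} {S : ℂ} (hS : HasSum a S) {W : ℝ}
    (hW : 0 ≤ W) {b : κ → ℝ} (hab : ∀ k, ‖a k‖ * W ≤ b k) :
    ‖S * (W : ℂ)‖ₑ ≤ ∑' k, ENNReal.ofReal (b k) := by
  have h1 := hS.mul_right (W : ℂ)
  rw [← h1.tsum_eq]
  refine enorm_tsum_le_tsum_enorm.trans (ENNReal.tsum_le_tsum fun k ↦ ?_)
  rw [← ofReal_norm, norm_mul, Complex.norm_real, Real.norm_eq_abs, abs_of_nonneg hW]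
  exact ENNReal.ofReal_le_ofReal (hab k)

variable {𝓑 : Type*} [NormedAddCommGroup 𝓑] [NormedSpace ℂ 𝓑]
variable {ι : 𝓑 →ₗ[ℂ] (Rd d × Rd d →ₘ[volume] ℂ)} {v : Rd d × Rd d → ℝ}

theorem exists_le_norm_on_ball {φ : 𝓢(Rd d, ℂ)} (hφ : φ ≠ 0) :
    ∃ (a : Rd d) (r c : ℝ), 0 < r ∧ 0 < c ∧ ∀ y, ‖y - a‖ ≤ r → c ≤ ‖φ y‖ := by
  obtain ⟨a, ha⟩ : ∃ a, φ a ≠ 0 := by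
    by_contra! h0
    exact hφ (SchwartzMap.ext h0)
  have h1 : ∀ᶠ y in 𝓝 a, ‖φ a‖ / 2 < ‖φ y‖ :=
    φ.continuous.norm.continuousAt.eventually_const_lt (half_lt_self (norm_pos_iff.2 ha))
  obtain ⟨r, hr, hball⟩ := Metric.eventually_nhds_iff.1 h1
  refine ⟨a, r / 2, ‖φ a‖ / 2, half_pos hr, half_pos (norm_pos_iff.2 ha), fun y hy ↦ (hball ?_).le⟩
  rw [dist_eq_norm]
  linarith

/-- Expanding `conj ϕ(· - y)` in characters expresses `V_ϕ u(y, ·)` through translates of `û`, and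
the cone lemma applies with `H(y, η) = (1 + |y|)^{-N} |û(η)| ω(x, η)`. -/
theorem memBF_stft_of_memBF_fourier (h : IsTranslationInvariantBFSpace ι v)
    {ω : Rd d × Rd d → ℝ} (hω : IsModerateWeight ω) (f : 𝓓'(X, ℂ)) {φ₀ : 𝓢(Rd d, ℂ)}
    (hφ₀ : φ₀ ≠ 0) (ϕ : 𝓢(Rd d, ℂ)) (x : Rd d) (χ : 𝓓(X, ℂ)) {Γ Γ' : Set (Rd d)}
    (hΓm : MeasurableSet Γ) (hΓm' : MeasurableSet Γ') {A : ℝ} (hA : 0 ≤ A)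
    (hΓΓ' : ∀ ξ ∈ Γ', ∀ η ∉ Γ, 1 + ‖η‖ ≤ A * (1 + ‖ξ - η‖))
    (hmem : MemBF ι fun p ↦ φ₀ p.1 * Γ.indicator (fun ξ ↦ fourier f χ ξ * (ω (x, ξ) : ℂ)) p.2) :
    MemBF ι ((univ ×ˢ Γ').indicator fun p ↦ stft ϕ f χ p * (ω p : ℂ)) := by
  obtain ⟨N, hcov, hdec⟩ := exists_memBF_decay h
  obtain ⟨a, r, c₀, hr, hc₀, hφr⟩ := exists_le_norm_on_ball hφ₀
  obtain ⟨Cω, N₁, hCω0, hCω⟩ := hω.exists_shift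
  obtain ⟨Cf, m, hCf0, hCf⟩ := exists_norm_fourier_le f χ
  obtain ⟨ε, K, c, hε, hK, hexp, hcdec, -⟩ := exists_expansion f χ
  obtain ⟨ρ, hρ⟩ := hK.isBounded.exists_norm_le
  let H : Rd d × Rd d → ℝ := fun p ↦ decay N p.1 * (‖fourier f χ p.2‖ * ω (x, p.2))
  have hωx : Measurable fun ξ ↦ ω (x, ξ) := hω.measurable.comp measurable_prodMk_left
  have hωp : ∀ p, 0 ≤ ω p := fun p ↦ (hω.pos p).le
  have hH0 : ∀ p, 0 ≤ H p := fun p ↦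
    mul_nonneg (decay_pos _ _).le (mul_nonneg (norm_nonneg _) (hωp _))
  have hHm : Measurable H := ((continuous_decay N).measurable.comp measurable_fst).mul
    (((measurable_fourier f χ).norm.comp measurable_snd).mul (hωx.comp measurable_snd))
  refine memBF_of_le_cone h hdec hA hΓΓ' hH0 (C := Cf * (Cω * ω (x, 0))) (m := m + N₁)
    (mul_nonneg hCf0 (mul_nonneg hCω0 (hωp _))) (fun y η ↦ ?_) ?_ ?_ hε (fun M ↦ ?_)
    (fun y ξ hξ ↦ indicator_of_notMem (fun hp ↦ hξ hp.2) _)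
  · have h1 := hCω x η x 0
    simp only [sub_self, norm_zero, add_zero, one_pow, one_mul, sub_zero] at h1
    calc H (y, η) ≤ decay N y * ((Cf * (1 + ‖η‖) ^ m) * (Cω * ω (x, 0) * (1 + ‖η‖) ^ N₁)) := by
          have := (decay_pos N y).le
          have := hωp (x, η)
          simp only [H]
          gcongr
          exact hCf η
      _ = _ := by rw [pow_add]; ring
  -- Since `|φ₀| ≥ c₀` on a ball, its translates replace `φ₀(y)` by `(1 + |y|)^{-N}`.
  · refine hcov Prod.fst (fun y ↦ (y, 0)) (fun y ↦ by simp) a r c₀⁻¹ hr (by positivity) _ _ hmem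
      ((Complex.measurable_ofReal.comp hHm).indicator
        (MeasurableSet.univ.prod hΓm)).aestronglyMeasurable fun p t hpt ↦ ?_
    simp only [Prod.fst_sub, Prod.snd_sub, sub_zero]
    by_cases hp : p.2 ∈ Γ
    · have hp' : p ∈ univ ×ˢ Γ := ⟨trivial, hp⟩
      rw [indicator_of_mem hp', indicator_of_mem hp, Complex.norm_real, Real.norm_eq_abs,
        abs_of_nonneg (hH0 p), norm_mul, norm_mul, Complex.norm_real, Real.norm_eq_abs,
        abs_of_nonneg (hωp _), ← mul_assoc, pow_mul_decay, one_mul, ← mul_assoc]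
      refine le_mul_of_one_le_left (mul_nonneg (norm_nonneg _) (hωp _)) ?_
      rw [inv_mul_eq_div, one_le_div hc₀]
      exact hφr _ hpt
    · have hp' : p ∉ univ ×ˢ Γ := fun hp' ↦ hp hp'.2
      rw [indicator_of_notMem hp', indicator_of_notMem hp]
      simp
  · exact (((measurable_stft ϕ f χ).mul (Complex.measurable_ofReal.comp
      hω.measurable)).indicator (MeasurableSet.univ.prod hΓm')).aestronglyMeasurable
  -- The extra `N₁` powers, in `k` here and in `y` below, pay for moving the weight from `(y, ξ)` to
  -- `(x, ξ + εk)`.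
  · obtain ⟨C₁, m₁, hC₁0, hC₁⟩ := hcdec (M + N₁)
    obtain ⟨C₂, hC₂0, hC₂⟩ := exists_norm_iteratedFDeriv_translate_le ϕ (N + N₁) m₁
    set C₃ := C₂ * (1 + |ρ|) ^ (N + N₁)
    have hC₃ : ∀ y k, ‖c (fun z ↦ conj (ϕ (z - y))) k‖ ≤
        C₁ * (C₃ * decay (N + N₁) y) * decay (M + N₁) (lat ε k) := by
      intro y k
      refine hC₁ _ (contDiff_conj_translate ϕ y) _
        (mul_nonneg (by positivity) (decay_pos _ _).le) (fun n hn z hz ↦ ?_) k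
      rw [norm_iteratedFDeriv_conj]
      refine (hC₂ y n hn z).trans ?_
      rw [mul_assoc]
      gcongr
      exact decay_le_of_norm_le _ ((hρ z hz).trans (le_abs_self ρ))
    refine ⟨C₁ * C₃ * Cω * (1 + ‖x‖) ^ N₁, by positivity, fun y ξ hξ ↦ ?_⟩
    have hp : (y, ξ) ∈ univ ×ˢ Γ' := ⟨trivial, hξ⟩
    rw [indicator_of_mem hp]
    have hsum : HasSum (fun k ↦ c (fun z ↦ conj (ϕ (z - y))) k * fourier f χ (ξ + lat ε k))
        (stft ϕ f χ (y, ξ)) := by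
      have h1 := (hexp (mulSmooth χ (character ξ) (contDiff_character ξ))
        (fun z hz ↦ left_ne_zero_of_mul hz) _ (contDiff_conj_translate ϕ y)).mul_left
        (((2 * Real.pi) ^ (-(d : ℝ) / 2) : ℝ) : ℂ)
      rw [mulSmooth_mulSmooth χ _ _ (contDiff_window ϕ y ξ) fun z ↦ by ring] at h1
      rw [stft_eq_pairing]
      refine h1.congr_fun fun k ↦ ?_
      rw [fourier_eq_pairing, mul_left_comm, mulSmooth_mulSmooth χ _ _
        (contDiff_character (ξ + lat ε k)) fun z ↦ by rw [character_add]]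
    refine enorm_mul_le_tsum_of_hasSum hsum (hωp _) fun k ↦ ?_
    have hω1 := hCω y ξ x (ξ + lat ε k)
    rw [sub_add_cancel_left, norm_neg] at hω1
    have h2 : 1 + ‖y - x‖ ≤ (1 + ‖y‖) * (1 + ‖x‖) := by
      have := one_add_norm_add_le y (-x)
      rwa [← sub_eq_add_neg, norm_neg] at this
    have hωk := hωp (x, ξ + lat ε k)
    have hd1 := (decay_pos (N + N₁) y).le
    have hd2 := (decay_pos (M + N₁) (lat ε k)).le
    have hC₃0 : 0 ≤ C₃ := by positivity
    rw [norm_mul]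
    calc ‖c (fun z ↦ conj (ϕ (z - y))) k‖ * ‖fourier f χ (ξ + lat ε k)‖ * ω (y, ξ)
        ≤ (C₁ * (C₃ * decay (N + N₁) y) * decay (M + N₁) (lat ε k)) *
            ‖fourier f χ (ξ + lat ε k)‖ * (Cω * ω (x, ξ + lat ε k) *
            (((1 + ‖y‖) * (1 + ‖x‖)) ^ N₁ * (1 + ‖lat ε k‖) ^ N₁)) := by
          have := hωp (y, ξ)
          gcongr
          · exact hC₃ y k
          · refine hω1.trans ?_
            gcongr
      _ = C₁ * C₃ * Cω * (1 + ‖x‖) ^ N₁ * decay M (lat ε k) * (decay N y *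
            (‖fourier f χ (ξ + lat ε k)‖ * ω (x, ξ + lat ε k))) *
            (((1 + ‖y‖) ^ N₁ * decay N₁ y) *
              ((1 + ‖lat ε k‖) ^ N₁ * decay N₁ (lat ε k))) := by
          rw [decay_add, decay_add, mul_pow]; ring
      _ = _ := by rw [pow_mul_decay, pow_mul_decay, mul_one, mul_one]

end Transforms

/-! ### From the short-time Fourier transform back, and wave-front sets -/

section Localization

variable {d : ℕ} {X : Opens (Rd d)}
variable {𝓑 : Type*} [NormedAddCommGroup 𝓑] [NormedSpace ℂ 𝓑]
variable {ι : 𝓑 →ₗ[ℂ] (Rd d × Rd d →ₘ[volume] ℂ)} {v : Rd d × Rd d → ℝ}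

/-- Multiply `1 / conj ϕ` by a bump supported where `ϕ` stays away from 0. The radius `2 * r` leaves
room for the sum of two displacements of size `r`, one in `z` and one in `y`. -/
theorem exists_local_inverse {ϕ : 𝓢(Rd d, ℂ)} (hϕ : ϕ ≠ 0) :
    ∃ (w₀ : Rd d) (r : ℝ) (κ : 𝓢(Rd d, ℂ)), 0 < r ∧
      ∀ w, ‖w - w₀‖ ≤ 2 * r → κ w * conj (ϕ w) = 1 := by
  obtain ⟨w₀, r, c, hr, hc, hϕr⟩ := exists_le_norm_on_ball hϕ
  have hne : ∀ w, ‖w - w₀‖ ≤ r → conj (ϕ w) ≠ 0 := fun w hw ↦ by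
    rw [Ne, map_eq_zero]
    exact norm_pos_iff.1 (hc.trans_le (hϕr w hw))
  let η : ContDiffBump w₀ := ⟨r / 2, r, half_pos hr, half_lt_self hr⟩
  let κ : Rd d → ℂ := fun w ↦ ((η w : ℝ) : ℂ) * (conj (ϕ w))⁻¹
  have hηc : HasCompactSupport fun w ↦ ((η w : ℝ) : ℂ) :=
    η.hasCompactSupport.comp_left (g := Complex.ofReal) rfl
  have hκc : HasCompactSupport κ := hηc.mul_right
  have hκ : ContDiff ℝ (⊤ : ℕ∞) κ := by
    refine contDiff_iff_contDiffAt.2 fun w ↦ ?_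
    by_cases hw : w ∈ tsupport κ
    swap
    · exact contDiffAt_const.congr_of_eventuallyEq (notMem_tsupport_iff_eventuallyEq.1 hw)
    have h1 : w ∈ tsupport η := by
      refine closure_mono (fun u hu ↦ ?_) hw
      contrapose! hu
      simp only [Function.mem_support, not_not] at hu ⊢
      simp [κ, hu]
    rw [η.tsupport_eq, Metric.mem_closedBall, dist_eq_norm] at h1
    exact (Complex.ofRealCLM.contDiff.comp η.contDiff).contDiffAt.mul
      ((Complex.conjCLE.contDiff.comp ϕ.smooth').contDiffAt.inv (hne w h1))
  refine ⟨w₀, r / 4, hκc.toSchwartzMap hκ, by positivity, fun w hw ↦ ?_⟩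
  have hη1 : η w = 1 := η.one_of_mem_closedBall (by
    rw [Metric.mem_closedBall, dist_eq_norm]
    change ‖w - w₀‖ ≤ r / 2
    linarith)
  change ((η w : ℝ) : ℂ) * (conj (ϕ w))⁻¹ * conj (ϕ w) = 1
  rw [hη1, Complex.ofReal_one, one_mul, inv_mul_cancel₀ (hne w (by linarith))]

/-- For every `y` in the ball `B`, multiplying by `ρ(z) κ(z - y)` removes the window and leaves `χ'
= χρ`. The new cutoff depends on `ϕ`, `χ` and `x₀` but not on the cones. -/
theorem memBF_fourier_of_memBF_stft (h : IsTranslationInvariantBFSpace ι v)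
    {ω : Rd d × Rd d → ℝ} (hω : IsModerateWeight ω) (f : 𝓓'(X, ℂ)) (φ₀ : 𝓢(Rd d, ℂ))
    {ϕ : 𝓢(Rd d, ℂ)} (hϕ : ϕ ≠ 0) (x : Rd d) (χ : 𝓓(X, ℂ)) {x₀ : Rd d} (hx₀ : χ x₀ ≠ 0) :
    ∃ χ' : 𝓓(X, ℂ), χ' x₀ ≠ 0 ∧ ∀ (Γ Γ' : Set (Rd d)) (A : ℝ), MeasurableSet Γ →
      MeasurableSet Γ' → 0 ≤ A → (∀ ξ ∈ Γ', ∀ η ∉ Γ, 1 + ‖η‖ ≤ A * (1 + ‖ξ - η‖)) →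
      MemBF ι ((univ ×ˢ Γ).indicator fun p ↦ stft ϕ f χ p * (ω p : ℂ)) →
      MemBF ι fun p ↦
        φ₀ p.1 * Γ'.indicator (fun ξ ↦ fourier f χ' ξ * (ω (x, ξ) : ℂ)) p.2 := by
  obtain ⟨w₀, r, κ, hr, hκ⟩ := exists_local_inverse hϕ
  let β : ContDiffBump x₀ := ⟨r / 2, r, half_pos hr, half_lt_self hr⟩
  let ρ : Rd d → ℂ := fun z ↦ ((β z : ℝ) : ℂ)
  have hρ : ContDiff ℝ (⊤ : ℕ∞) ρ := Complex.ofRealCLM.contDiff.comp β.contDiff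
  have hρc : HasCompactSupport ρ := β.hasCompactSupport.comp_left (g := Complex.ofReal) rfl
  set B : Set (Rd d) := Metric.closedBall (x₀ - w₀) r
  have hχ' : mulSmooth χ ρ hρ x₀ ≠ 0 := by
    have : β x₀ = 1 := β.one_of_mem_closedBall (Metric.mem_closedBall_self β.rIn_pos.le)
    simpa [ρ, this] using hx₀
  refine ⟨mulSmooth χ ρ hρ, hχ', fun Γ Γ' A hΓm hΓm' hA hΓΓ' hmem ↦ ?_⟩
  set χ' := mulSmooth χ ρ hρ
  obtain ⟨N, hcov, hdec⟩ := exists_memBF_decay h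
  obtain ⟨Cω, N₁, hCω0, hCω⟩ := hω.exists_shift
  obtain ⟨Cv, m, hCv0, hCv⟩ := exists_norm_stft_le ϕ f χ
  obtain ⟨ε, K, c, hε, hK, hexp, hcdec, -⟩ := exists_expansion f χ
  set R : ℝ := ‖x₀ - w₀‖ + r
  have hR : 0 ≤ R := by positivity
  have hBR : ∀ y ∈ B, ‖y‖ ≤ R := fun y hy ↦ by
    rw [Metric.mem_closedBall, dist_eq_norm] at hy
    have := norm_add_le (x₀ - w₀) (y - (x₀ - w₀))
    rw [add_sub_cancel] at this
    linarith
  have hBm : MeasurableSet B := measurableSet_closedBall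
  have hωx : Measurable fun ξ ↦ ω (x, ξ) := hω.measurable.comp measurable_prodMk_left
  have hωp : ∀ p, 0 ≤ ω p := fun p ↦ (hω.pos p).le
  let H : Rd d × Rd d → ℝ := (B ×ˢ univ).indicator fun p ↦ ‖stft ϕ f χ p‖ * ω p
  have hH0 : ∀ p, 0 ≤ H p := fun p ↦
    indicator_nonneg (fun p _ ↦ mul_nonneg (norm_nonneg _) (hωp _)) p
  have hHm : Measurable H :=
    ((measurable_stft ϕ f χ).norm.mul hω.measurable).indicator (hBm.prod MeasurableSet.univ)
  have hHB : ∀ y ∈ B, ∀ η, H (y, η) = ‖stft ϕ f χ (y, η)‖ * ω (y, η) := fun y hy η ↦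
    indicator_of_mem (show (y, η) ∈ B ×ˢ univ from ⟨hy, trivial⟩) _
  have hHB' : ∀ y ∉ B, ∀ η, H (y, η) = 0 := fun y hy η ↦
    indicator_of_notMem (fun hp ↦ hy hp.1) _
  -- `F` does not vary with `y` inside `B`; `1_B` stands in for `φ₀` until the last step.
  let F : Rd d × Rd d → ℂ :=
    (B ×ˢ Γ').indicator fun p ↦ fourier f χ' p.2 * (ω (x, p.2) : ℂ)
  have hFm : Measurable F :=
    (((measurable_fourier f χ').comp measurable_snd).mul (Complex.measurable_ofReal.comp
      (hωx.comp measurable_snd))).indicator (hBm.prod hΓm')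
  have hF : MemBF ι F := by
    refine memBF_of_le_cone h hdec hA hΓΓ' hH0
      (C := Cv * (Cω * ω (0, 0) * (1 + R) ^ (N₁ + N))) (m := m + N₁)
      (mul_nonneg hCv0 (mul_nonneg (mul_nonneg hCω0 (hωp _)) (by positivity)))
      (fun y η ↦ ?_) ?_ hFm.aestronglyMeasurable hε (fun M ↦ ?_)
      (fun y ξ hξ ↦ indicator_of_notMem (fun hp ↦ hξ hp.2) _)
    · by_cases hy : y ∈ B
      · rw [hHB y hy]
        have h1 := hCω y η 0 0
        rw [sub_zero, sub_zero] at h1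
        -- On the bounded set `B` the factor `decay N y` demanded by the cone lemma is bounded
        -- below.
        have h2 : (1 + ‖y‖) ^ N₁ ≤ (1 + R) ^ (N₁ + N) * decay N y :=
          calc (1 + ‖y‖) ^ N₁ = (1 + ‖y‖) ^ (N₁ + N) * decay N y := by
                rw [pow_add, mul_assoc, pow_mul_decay, mul_one]
            _ ≤ _ := by
                have := (decay_pos N y).le
                gcongr
                exact hBR y hy
        have h0 := hωp ((0 : Rd d), (0 : Rd d))
        calc ‖stft ϕ f χ (y, η)‖ * ω (y, η)
            ≤ (Cv * (1 + ‖η‖) ^ m) * (Cω * ω (0, 0) *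
                (((1 + R) ^ (N₁ + N) * decay N y) * (1 + ‖η‖) ^ N₁)) := by
              have := hωp (y, η)
              gcongr
              · exact hCv y η
              · refine h1.trans ?_
                gcongr
          _ = _ := by rw [pow_add (1 + ‖η‖)]; ring
      · rw [hHB' y hy]
        have := (decay_pos N y).le
        have := hωp ((0 : Rd d), (0 : Rd d))
        positivity
    · refine hmem.of_norm_le h ((Complex.measurable_ofReal.comp hHm).indicator
        (MeasurableSet.univ.prod hΓm)).aestronglyMeasurable (.of_forall fun p ↦ ?_)
      rw [norm_indicator_eq_indicator_norm, norm_indicator_eq_indicator_norm]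
      refine indicator_le_indicator ?_
      rw [Complex.norm_real, Real.norm_eq_abs, abs_of_nonneg (hH0 p), norm_mul,
        Complex.norm_real, Real.norm_eq_abs, abs_of_nonneg (hωp p)]
      exact indicator_le_self' (fun p _ ↦ mul_nonneg (norm_nonneg _) (hωp p)) p
    · obtain ⟨C₁, m₁, hC₁0, hC₁⟩ := hcdec (M + N₁)
      obtain ⟨C₂, hC₂0, hC₂⟩ := exists_norm_iteratedFDeriv_translate_le κ 0 m₁
      obtain ⟨A₁, hA₁0, hA₁⟩ := exists_norm_iteratedFDeriv_le
        (X := (⊤ : Opens (Rd d))) ⟨ρ, hρ, hρc, fun _ _ ↦ trivial⟩ m₁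
      have hκs : ∀ y, ContDiff ℝ (⊤ : ℕ∞) fun z ↦ κ (z - y) := fun y ↦
        κ.smooth'.comp (contDiff_id.sub contDiff_const)
      have hg : ∀ y, ContDiff ℝ (⊤ : ℕ∞) fun z ↦ ρ z * κ (z - y) := fun y ↦ hρ.mul (hκs y)
      set C₃ := 2 ^ m₁ * (A₁ * C₂)
      have hC₃0 : 0 ≤ C₃ := by positivity
      have hC₃ : ∀ y k, ‖c (fun z ↦ ρ z * κ (z - y)) k‖ ≤
          C₁ * C₃ * decay (M + N₁) (lat ε k) := by
        intro y k
        refine hC₁ _ (hg y) _ hC₃0 (fun n hn z _ ↦ ?_) k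
        refine (norm_iteratedFDeriv_mul_le_of_le hρ (hκs y) hA₁0
          (fun i hi ↦ hA₁ i (hi.trans hn) z)
          fun i hi ↦ by simpa [decay] using hC₂ y i (hi.trans hn) z).trans ?_
        simp only [C₃]
        gcongr
        norm_num
      refine ⟨C₁ * C₃ * Cω * ((1 + R) * (1 + ‖x‖)) ^ N₁, by positivity, fun y ξ hξ ↦ ?_⟩
      by_cases hy : y ∈ B
      swap
      · have hp : (y, ξ) ∉ B ×ˢ Γ' := fun hp ↦ hy hp.1
        simp [F, hp]
      have hp : (y, ξ) ∈ B ×ˢ Γ' := ⟨hy, hξ⟩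
      simp only [F]
      rw [indicator_of_mem hp]
      have hsum : HasSum (fun k ↦ c (fun z ↦ ρ z * κ (z - y)) k *
          stft ϕ f χ (y, ξ + lat ε k)) (fourier f χ' ξ) := by
        have h1 := (hexp (mulSmooth χ _ (contDiff_window ϕ y ξ))
          (fun z hz ↦ left_ne_zero_of_mul hz) _ (hg y)).mul_left
          (((2 * Real.pi) ^ (-(d : ℝ) / 2) : ℝ) : ℂ)
        have h2 : mulSmooth (mulSmooth χ _ (contDiff_window ϕ y ξ)) _ (hg y) =
            mulSmooth χ' (character ξ) (contDiff_character ξ) := by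
          ext z
          simp only [mulSmooth_apply, χ']
          by_cases hz : ρ z = 0
          · simp [hz]
          · have hz' : ‖z - x₀‖ < r := by
              rw [← dist_eq_norm]
              by_contra! hle
              exact hz (by simp [ρ, β.zero_of_le_dist hle])
            have hy' : ‖y - (x₀ - w₀)‖ ≤ r := by
              rwa [← dist_eq_norm]
            have h3 := hκ (z - y) (by
              have h4 : z - y - w₀ = (z - x₀) - (y - (x₀ - w₀)) := by abel
              rw [h4]
              exact (norm_sub_le _ _).trans (by linarith))
            linear_combination (χ z * ρ z * character ξ z) * h3
        rw [h2] at h1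
        rw [fourier_eq_pairing]
        refine h1.congr_fun fun k ↦ ?_
        rw [stft_eq_pairing, mul_left_comm, mulSmooth_mulSmooth χ _ _
          (contDiff_window ϕ y (ξ + lat ε k)) fun z ↦ by rw [character_add]; ring]
      refine enorm_mul_le_tsum_of_hasSum hsum (hωp _) fun k ↦ ?_
      have hω1 := hCω x ξ y (ξ + lat ε k)
      rw [sub_add_cancel_left, norm_neg] at hω1
      have h2 : 1 + ‖x - y‖ ≤ (1 + R) * (1 + ‖x‖) := by
        have h3 := one_add_norm_add_le x (-y)
        rw [← sub_eq_add_neg, norm_neg, mul_comm] at h3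
        refine h3.trans ?_
        gcongr
        exact hBR y hy
      have hωk := hωp (y, ξ + lat ε k)
      have hd2 := (decay_pos (M + N₁) (lat ε k)).le
      rw [norm_mul, hHB y hy]
      calc ‖c (fun z ↦ ρ z * κ (z - y)) k‖ * ‖stft ϕ f χ (y, ξ + lat ε k)‖ * ω (x, ξ)
          ≤ (C₁ * C₃ * decay (M + N₁) (lat ε k)) * ‖stft ϕ f χ (y, ξ + lat ε k)‖ *
              (Cω * ω (y, ξ + lat ε k) *
              (((1 + R) * (1 + ‖x‖)) ^ N₁ * (1 + ‖lat ε k‖) ^ N₁)) := by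
            have := hωp (x, ξ)
            gcongr
            · exact hC₃ y k
            · refine hω1.trans ?_
              gcongr
        _ = C₁ * C₃ * Cω * ((1 + R) * (1 + ‖x‖)) ^ N₁ * decay M (lat ε k) *
              (‖stft ϕ f χ (y, ξ + lat ε k)‖ * ω (y, ξ + lat ε k)) *
              ((1 + ‖lat ε k‖) ^ N₁ * decay N₁ (lat ε k)) := by
            rw [decay_add]; ring
        _ = _ := by rw [pow_mul_decay, mul_one]
  obtain ⟨C₀, hC₀0, hC₀⟩ := exists_norm_iteratedFDeriv_translate_le φ₀ N 0
  have hmeas : Measurable fun p : Rd d × Rd d ↦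
      φ₀ p.1 * Γ'.indicator (fun ξ ↦ fourier f χ' ξ * (ω (x, ξ) : ℂ)) p.2 :=
    (φ₀.continuous.measurable.comp measurable_fst).mul
      ((((measurable_fourier f χ').mul (Complex.measurable_ofReal.comp hωx)).indicator hΓm').comp
        measurable_snd)
  -- Translates of `B` cover `ℝ^d`, and `φ₀` decays to order `N`, so `1_B` can be replaced by `φ₀`.
  refine hcov Prod.fst (fun y ↦ (y, 0)) (fun y ↦ by simp) (x₀ - w₀) r C₀ hr hC₀0 _ _ hF
    hmeas.aestronglyMeasurable fun p t hpt ↦ ?_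
  have h1 : F (p - (t, 0)) = Γ'.indicator (fun ξ ↦ fourier f χ' ξ * (ω (x, ξ) : ℂ)) p.2 := by
    have hpB : p.1 - t ∈ B := by rwa [Metric.mem_closedBall, dist_eq_norm]
    by_cases hp : p.2 ∈ Γ'
    · have hp' : p - (t, 0) ∈ B ×ˢ Γ' := ⟨hpB, by simpa using hp⟩
      simp only [F]
      rw [indicator_of_mem hp', indicator_of_mem hp]
      simp
    · have hp' : p - (t, 0) ∉ B ×ˢ Γ' := fun hp' ↦ hp (by simpa using hp'.2)
      simp only [F]
      rw [indicator_of_notMem hp', indicator_of_notMem hp]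
  rw [h1, norm_mul, ← mul_assoc]
  refine mul_le_mul_of_nonneg_right ?_ (norm_nonneg _)
  have h2 := hC₀ 0 0 le_rfl p.1
  rw [norm_iteratedFDeriv_zero] at h2
  simp only [sub_zero] at h2
  calc (1 + ‖p.1‖) ^ N * ‖φ₀ p.1‖ ≤ (1 + ‖p.1‖) ^ N * (C₀ * decay N p.1) := by gcongr
    _ = C₀ * ((1 + ‖p.1‖) ^ N * decay N p.1) := by ring
    _ = C₀ := by rw [pow_mul_decay, mul_one]

theorem notMem_singularDirections_iff {S : Set (Rd d) → ℝ≥0∞} {ξ : Rd d} (hξ : ξ ≠ 0) :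
    ξ ∉ singularDirections S ↔ ∃ Γ, IsOpenCone Γ ∧ ξ ∈ Γ ∧ S Γ < ∞ := by
  simp [singularDirections, regularDirections, hξ, lt_top_iff_ne_top]

/-- By contraposition: regularity for `T` with one cutoff has to give regularity for `S` with some
cutoff and some cone, both of which may change. -/
theorem waveFrontSet_subset {S T : 𝓓(X, ℂ) → Set (Rd d) → ℝ≥0∞}
    (h : ∀ (χ : 𝓓(X, ℂ)) (x ξ : Rd d), χ x ≠ 0 → ∀ Γ, IsOpenCone Γ → ξ ∈ Γ → T χ Γ < ∞ →
      ∃ χ' : 𝓓(X, ℂ), χ' x ≠ 0 ∧ ∃ Γ', IsOpenCone Γ' ∧ ξ ∈ Γ' ∧ S χ' Γ' < ∞) :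
    waveFrontSet X S ⊆ waveFrontSet X T := by
  rintro ⟨x, ξ⟩ ⟨hx, hξ, hS⟩
  refine ⟨hx, hξ, fun χ hχ ↦ ?_⟩
  by_contra hT
  obtain ⟨Γ, hΓ, hξΓ, hfin⟩ := (notMem_singularDirections_iff hξ).1 hT
  obtain ⟨χ', hχ', hreg⟩ := h χ x ξ hχ Γ hΓ hξΓ hfin
  exact (notMem_singularDirections_iff hξ).2 hreg (hS χ' hχ')

end Localization

end WFModulation

end

theorem mainTheorem6 {d : ℕ}
    {𝓑 : Type*} [NormedAddCommGroup 𝓑] [NormedSpace ℂ 𝓑]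
    (ι : 𝓑 →ₗ[ℂ] (WFModulation.Rd d × WFModulation.Rd d →ₘ[volume] ℂ))
    (v : WFModulation.Rd d × WFModulation.Rd d → ℝ)
    (h𝓑 : WFModulation.IsTranslationInvariantBFSpace ι v)
    (ω : WFModulation.Rd d × WFModulation.Rd d → ℝ)
    (hω : WFModulation.IsModerateWeight ω)
    (X : Opens (WFModulation.Rd d)) (f : 𝓓'(X, ℂ))
    (φ₀ : 𝓢(WFModulation.Rd d, ℂ)) (hφ₀ : φ₀ ≠ 0)
    (ϕ : 𝓢(WFModulation.Rd d, ℂ)) (hϕ : ϕ ≠ 0) (x : WFModulation.Rd d) :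
    WFModulation.waveFrontSetFourier (WFModulation.projNorm ι φ₀) ω x f =
      WFModulation.waveFrontSetModulation ι ω ϕ f := by
  refine Subset.antisymm ?_ ?_
  · refine WFModulation.waveFrontSet_subset fun χ x₀ ξ₀ hχ Γ hΓ hξΓ hfin ↦ ?_
    obtain ⟨χ', hχ', himp⟩ :=
      WFModulation.memBF_fourier_of_memBF_stft h𝓑 hω f φ₀ hϕ x χ hχ
    obtain ⟨Γ', A, hΓ', hξΓ', hA, hsep⟩ := hΓ.exists_shrink hξΓ
    refine ⟨χ', hχ', Γ', hΓ', hξΓ', WFModulation.bfNorm_lt_top_iff.2 ?_⟩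
    exact himp Γ Γ' A hΓ.isOpen.measurableSet hΓ'.isOpen.measurableSet hA hsep
      (WFModulation.bfNorm_lt_top_iff.1 hfin)
  · refine WFModulation.waveFrontSet_subset fun χ x₀ ξ₀ hχ Γ hΓ hξΓ hfin ↦ ?_
    obtain ⟨Γ', A, hΓ', hξΓ', hA, hsep⟩ := hΓ.exists_shrink hξΓ
    refine ⟨χ, hχ, Γ', hΓ', hξΓ', WFModulation.bfNorm_lt_top_iff.2 ?_⟩
    exact WFModulation.memBF_stft_of_memBF_fourier h𝓑 hω f hφ₀ ϕ x χ hΓ.isOpen.measurableSet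
      hΓ'.isOpen.measurableSet hA hsep (WFModulation.bfNorm_lt_top_iff.1 hfin)
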